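/- **Setting.** Fix $b>0$ and $\nu>0$. Let $\Omega=\{x=(x_1,x_h): -b<x_1<0,\ x_h=(x_2,x_3)\in\mathbb R^2\}$, $\Sigma_0=\{x_1=0\}$, $\Sigma_b=\{x_1=-b\}$. Write $\partial_h=(\partial_2,\partial_3)$, and let $\dot\Lambda_h^{s}$ be the horizontal Fourier multiplier with symbol $|\varsigma_h|^s$. Let $$\|f\|^2_{\mathcal H^s_{\mathrm{tan},N}}=\sum_{i=0}^N\|\partial_h^i f\|^2_{H^s(\Omega)},\qquad \|f\|^2_{\mathring{\mathcal H}^{2,\Sigma_0}_{\mathrm{tan},N}}=\sum_{i=0}^N\big(\|\partial_h^i f^1\|^2_{H^1(\Sigma_0)}+\|\partial_h^i\nabla f\|^2_{H^1(\Omega)}\big),$$ where $\mathcal H^s_{\mathrm{tan},N}$ is the space of $f\in H^s(\Omega)$ for which the first norm is finite, $\mathcal H^s_{0,\mathrm{tan},N}$ is its subspace with $f|_{\Sigma_b}=0$, and $\mathring{\mathcal H}^{2,\Sigma_0}_{\mathrm{tan},N}$ is the space of vector fields $f\in H^2(\Omega)$ for which the second norm is finite. For $\sigma_0\in(\tfrac12,1)$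 let $$\mathbf E=C_b([0,\infty);\mathcal H^1_{0,\mathrm{tan},3})\cap L^2_{\mathrm{loc}}([0,\infty);\mathcal H^2_{\mathrm{tan},3})\cap L^1([0,\infty);\dot\Lambda_h^{-\sigma_0}\mathcal H^2_{\mathrm{tan},2})\cap L^2([0,\infty);\dot\Lambda_h^{-1}\mathcal H^1_{\mathrm{tan},3}),$$ where $v\in L^p(\dot\Lambda_h^{-s}X)$ means $\dot\Lambda_h^{s}v\in L^p(X)$. For a displacement $\xi$ put $J=\det(I+D\xi)$ and $\mathcal A=(I+D\xi)^{-T}$ (where $J\neq0$ almost everywhere in $\Omega$ and on $\Sigma_0$). Put $(\nabla_{\mathcal A}f)_i=\mathcal A_i^j\partial_j f$, $\nabla_{\mathcal A}\cdot v=\mathcal A_i^j\partial_j v^i$, $\mathbb D_{\mathcal A}(v)_{ij}=\mathcal A_i^k\partial_k v^j+\mathcal A_j^k\partial_k v^i$, and $\mathcal N=J\mathcal A\,(1,0,0)^T$. The viscous surface wave problem in Lagrangian coordinates, with data $(\xi_0,v_0)$, is $$\begin{cases}\partial_t\xi=v,\quad \partial_t v+\nabla_{\mathcal A}q-\nu\nabla_{\mathcal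 A}\cdot\mathbb D_{\mathcal A}(v)=0,\quad \nabla_{\mathcal A}\cdot v=0&\text{in }\Omega,\\ (q-\xi^1)\mathcal N-\nu\,\mathbb D_{\mathcal A}(v)\mathcal N=0&\text{on }\Sigma_0,\\ v=0&\text{on }\Sigma_b,\\ \xi|_{t=0}=\xi_0,\quad v|_{t=0}=v_0,\end{cases}$$ where weak derivatives, distributional time derivatives of $v$ and traces are used. **Theorem (non-decay).** Let $\sigma_0\in(\tfrac12,1)$. There is a vector field $\theta\in\mathring{\mathcal H}^{2,\Sigma_0}_{\mathrm{tan},3}(\Omega)$ with $\nabla\cdot\theta=0$ for which there is no family $(v(\varepsilon),q(\varepsilon),\xi(\varepsilon))$, $0<\varepsilon<\varepsilon_0$ (for any $\varepsilon_0>0$), with all of the following properties: 1. for each $\varepsilon$, $v(\varepsilon)\in\mathbf E$, $q(\varepsilon)\in L^2_{\mathrm{loc}}([0,\infty);\mathcal H^1_{\mathrm{tan},3})$, and $\xi(\varepsilon)\in C([0,\infty);\mathring{\mathcal H}^{2,\Sigma_0}_{\mathrm{tan},3})\cap C_b([0,\infty);H^4(\Sigma_0))\cap C_b([0,\infty);\mathring{\mathcal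 H}^{2,\Sigma_0}_{\mathrm{tan},2})$; 2. for each $\varepsilon$, $(\xi(\varepsilon),v(\varepsilon),q(\varepsilon))$ solves the viscous surface wave problem on $[0,\infty)$ with data $\xi_0=\varepsilon\theta$, $v_0=0$; 3. for each $\varepsilon$, $\|\xi^1(\varepsilon)(t)\|_{H^2(\Sigma_0)}\to0$ as $t\to\infty$; 4. $v(\varepsilon)=\varepsilon v^{(1)}+\varepsilon^2v^{(2)}+\varepsilon^3v^{(3)}$ in $\mathbf E$, where $v^{(1)},v^{(2)}\in\mathbf E$ do not depend on $\varepsilon$, and $v^{(3)}=v^{(3)}(\varepsilon)\in\mathbf E$ may depend on $\varepsilon$ but is bounded in $\mathbf E$ (in each of its defining seminorms) uniformly in $\varepsilon$. -/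

import Mathlib

open MeasureTheory Filter Topology Set
open scoped ENNReal NNReal ContDiff

noncomputable section

namespace ViscousSurface

/-! ### Weak derivatives and Sobolev norms

All norms below are extended norms, with values in `[0, ∞]`: a function belongs to the
corresponding space exactly when its norm is finite. They are given through their squares. -/

/-- Euclidean space `ℝⁿ`. In `ℝ³` the coordinate `0` is the vertical one (the paper's `x₁`), and
the coordinates `1, 2` are the horizontal ones (the paper's `x_h = (x₂, x₃)`). -/
abbrev Eu (n : ℕ) : Type := EuclideanSpace ℝ (Fin n)

/-- The Hilbert space `L²(U)` of real functions. -/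
abbrev L2 {n : ℕ} (U : Set (Eu n)) : Type := Lp ℝ 2 (volume.restrict U)

/-- `φ ∈ C_c^∞(U)`. -/
def IsTest {n : ℕ} (U : Set (Eu n)) (φ : Eu n → ℝ) : Prop :=
  ContDiff ℝ ∞ φ ∧ HasCompactSupport φ ∧ tsupport φ ⊆ U

/-- The classical partial derivative `∂ᵢ φ`. -/
def pd {n : ℕ} (i : Fin n) (φ : Eu n → ℝ) (x : Eu n) : ℝ :=
  fderiv ℝ φ x (EuclideanSpace.single i 1)

/-- `g = ∂ᵢ f` in the weak sense on `U`. -/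
def IsWeakDeriv {n : ℕ} (U : Set (Eu n)) (i : Fin n) (f g : Eu n → ℝ) : Prop :=
  LocallyIntegrableOn f U ∧ LocallyIntegrableOn g U ∧
    ∀ φ : Eu n → ℝ, IsTest U φ → ∫ x in U, f x * pd i φ x = - ∫ x in U, g x * φ x

/-- `w = ∂_{i₁} ⋯ ∂_{iₖ} u` for the list `[i₁, …, iₖ]`, all derivatives being weak ones and
lying in `L²(U)`. -/
def IsIterDeriv {n : ℕ} (U : Set (Eu n)) : List (Fin n) → L2 U → L2 U → Prop
  | [], u, w => u = w
  | i :: l, u, w => ∃ z : L2 U, IsIterDeriv U l u z ∧ IsWeakDeriv U i z w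

/-- `N (∂_{i₁} ⋯ ∂_{iₖ} u)`, and `∞` if this derivative does not exist in `L²(U)`. -/
def onDeriv {n : ℕ} (U : Set (Eu n)) (l : List (Fin n)) (N : L2 U → ℝ≥0∞) (u : L2 U) : ℝ≥0∞ :=
  ⨅ (w : L2 U) (_ : IsIterDeriv U l u w), N w

/-- `‖u‖²_{H^s(U)}`. -/
def sobSq {n : ℕ} (U : Set (Eu n)) (s : ℕ) (u : L2 U) : ℝ≥0∞ :=
  ∑ k ∈ Finset.range (s + 1), ∑ α : Fin k → Fin n, onDeriv U (List.ofFn α) (fun w => ‖w‖ₑ ^ 2) u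

/-! ### The slab, its boundary, horizontal operators -/

/-- The equilibrium domain `Ω = {-b < x₁ < 0}`. -/
def slab (b : ℝ) : Set (Eu 3) := {x | -b < x 0 ∧ x 0 < 0}

/-- The point `(s, y)` with height `s` and horizontal position `y`. -/
def pt (s : ℝ) (y : Eu 2) : Eu 3 := !₂[s, y 0, y 1]

/-- Vector fields of class `L²(Ω)`. -/
abbrev VF (b : ℝ) : Type := Fin 3 → L2 (slab b)

/-- Functions of class `L²` on the horizontal plane (functions on `Σ₀` or `Σ_b`). -/
abbrev Surf : Type := L2 (univ : Set (Eu 2))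

/-- `g` is the trace of `u` on the top surface `Σ₀ = {x₁ = 0}`, by Green's formula; the test
functions vanish near the bottom. -/
def IsTraceTop (b : ℝ) (u : L2 (slab b)) (g : Surf) : Prop :=
  ∃ w : L2 (slab b), IsWeakDeriv (slab b) 0 u w ∧
    ∀ φ : Eu 3 → ℝ, IsTest {x | -b < x 0} φ →
      ∫ x in slab b, (u x * pd 0 φ x + w x * φ x) = ∫ y, g y * φ (pt 0 y)

/-- `g` is the trace of `u` on the bottom `Σ_b = {x₁ = -b}`, by Green's formula; the test
functions vanish near the top. -/
def IsTraceBot (b : ℝ) (u : L2 (slab b)) (g : Surf) : Prop :=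
  ∃ w : L2 (slab b), IsWeakDeriv (slab b) 0 u w ∧
    ∀ φ : Eu 3 → ℝ, IsTest {x | x 0 < 0} φ →
      ∫ x in slab b, (u x * pd 0 φ x + w x * φ x) = - ∫ y, g y * φ (pt (-b) y)

/-- `N (u|_{Σ₀})`, and `∞` if the trace does not exist. -/
def onTop (b : ℝ) (N : Surf → ℝ≥0∞) (u : L2 (slab b)) : ℝ≥0∞ :=
  ⨅ (g : Surf) (_ : IsTraceTop b u g), N g

/-- The horizontal slice `f(s, ·)`, as a complex function on the plane. -/
def slice (f : Eu 3 → ℝ) (s : ℝ) : Eu 2 → ℂ := fun y => (f (pt s y) : ℂ)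

/-- `g = Λ̇_h^σ u`: on almost every horizontal slice, the Fourier transform of `g` is that of `u`
times `|ς|^σ`. In Mathlib's normalization of the Fourier transform the frequency is
`ς = 2πζ`. -/
def IsHorizLambda (b σ : ℝ) (u g : L2 (slab b)) : Prop :=
  ∀ᵐ s ∂(volume.restrict (Ioo (-b) 0)),
    ∃ (hu : MemLp (slice u s) 2 volume) (hg : MemLp (slice g s) 2 volume),
      ∀ᵐ ζ : Eu 2, Lp.fourierTransformₗᵢ (Eu 2) ℂ (hg.toLp _) ζ =
        (((2 * Real.pi * ‖ζ‖) ^ σ : ℝ) : ℂ) * Lp.fourierTransformₗᵢ (Eu 2) ℂ (hu.toLp _) ζ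

/-- `N (Λ̇_h^σ u)`, acting on vector fields componentwise; `∞` if `Λ̇_h^σ u` is not in `L²(Ω)`. -/
def onLambda (b σ : ℝ) (N : VF b → ℝ≥0∞) (u : VF b) : ℝ≥0∞ :=
  ⨅ (g : VF b) (_ : ∀ i, IsHorizLambda b σ (u i) (g i)), N g

/-- The horizontal multi-index `β` (with entries in `{0, 1}`) as a list of coordinates of `ℝ³`. -/
def hor {i : ℕ} (β : Fin i → Fin 2) : List (Fin 3) := List.ofFn fun j => (β j).succ

/-- `‖u‖²_{𝓗^s_{tan,N}(Ω)} = ∑_{i ≤ N} ‖∂_h^i u‖²_{H^s(Ω)}` for scalar functions. -/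
def tanSq (b : ℝ) (s N : ℕ) (u : L2 (slab b)) : ℝ≥0∞ :=
  ∑ i ∈ Finset.range (N + 1), ∑ β : Fin i → Fin 2, onDeriv (slab b) (hor β) (sobSq (slab b) s) u

/-- `‖f‖²_{𝓗^s_{tan,N}(Ω)}` for vector fields. -/
def tanSqV (b : ℝ) (s N : ℕ) (f : VF b) : ℝ≥0∞ := ∑ j, tanSq b s N (f j)

/-- `∑_{i ≤ N} (‖∂_h^i f¹‖²_{H¹(Σ₀)} + ‖∂_h^i ∇f‖²_{H¹(Ω)})`, the square of the norm of
`𝓗̊^{2,Σ₀}_{tan,N}(Ω)`. -/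
def circSq (b : ℝ) (N : ℕ) (f : VF b) : ℝ≥0∞ :=
  ∑ i ∈ Finset.range (N + 1), ∑ β : Fin i → Fin 2,
    (onTop b (onDeriv univ (List.ofFn β) (sobSq univ 1)) (f 0) +
      ∑ j : Fin 3, ∑ m : Fin 3, onDeriv (slab b) (hor β ++ [m]) (sobSq (slab b) 1) (f j))

/-- `f ∈ 𝓗̊^{2,Σ₀}_{tan,N}(Ω)`. -/
def MemCirc (b : ℝ) (N : ℕ) (f : VF b) : Prop := tanSqV b 2 0 f < ⊤ ∧ circSq b N f < ⊤

/-- `‖f‖²_{H⁴(Σ₀)}` for the trace of a vector field. -/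
def surfSq (b : ℝ) (f : VF b) : ℝ≥0∞ := ∑ j, onTop b (sobSq univ 4) (f j)

/-! ### Spaces of time-dependent functions on `[0, ∞)`

Functions of time are defined on `ℝ`; only their values at `t ≥ 0` matter. -/

/-- `u ∈ C([0, ∞); X)`, where `N` is the squared extended norm of `X`. -/
def ContIn {b : ℝ} (N : VF b → ℝ≥0∞) (u : ℝ → VF b) : Prop :=
  (∀ t, 0 ≤ t → N (u t) < ⊤) ∧
    ∀ t₀, 0 ≤ t₀ → Tendsto (fun t => N (u t - u t₀)) (𝓝[Ici 0] t₀) (𝓝 0)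

/-- `u ∈ C_b([0, ∞); X)`. -/
def BddContIn {b : ℝ} (N : VF b → ℝ≥0∞) (u : ℝ → VF b) : Prop :=
  ContIn N u ∧ ∃ C : ℝ≥0, ∀ t, 0 ≤ t → N (u t) ≤ C

/-- `v` lies in the space
`𝐄 = C_b([0,∞); 𝓗¹_{0,tan,3}) ∩ L²_loc([0,∞); 𝓗²_{tan,3})
  ∩ L¹([0,∞); Λ̇_h^{-σ} 𝓗²_{tan,2}) ∩ L²([0,∞); Λ̇_h^{-1} 𝓗¹_{tan,3})`,
with its seminorms bounded by `C` (the global ones) and by `K T` (the one over `[0, T]`). Strong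
measurability in time follows from the continuity. -/
structure BoundedInE (b σ : ℝ) (C : ℝ≥0) (K : ℝ → ℝ≥0) (v : ℝ → VF b) : Prop where
  cont : ContIn (tanSqV b 1 3) v
  bottom : ∀ t, 0 ≤ t → ∀ j, IsTraceBot b (v t j) 0
  bdd : ∀ t, 0 ≤ t → tanSqV b 1 3 (v t) ≤ C
  l2loc : ∀ T, 0 ≤ T → ∫⁻ t in Icc 0 T, tanSqV b 2 3 (v t) ≤ K T
  l1 : ∫⁻ t in Ici 0, (onLambda b σ (tanSqV b 2 2) (v t)) ^ (1 / 2 : ℝ) ≤ C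
  l2 : ∫⁻ t in Ici 0, onLambda b 1 (tanSqV b 1 3) (v t) ≤ C

/-- `v ∈ 𝐄`. -/
def MemE (b σ : ℝ) (v : ℝ → VF b) : Prop := ∃ C K, BoundedInE b σ C K v

/-- `q ∈ L²_loc([0,∞); 𝓗¹_{tan,3}(Ω))`. -/
def MemPressure (b : ℝ) (q : ℝ → L2 (slab b)) : Prop :=
  AEStronglyMeasurable q (volume.restrict (Ici 0)) ∧
    ∀ T, 0 ≤ T → ∫⁻ t in Icc 0 T, tanSq b 1 3 (q t) < ⊤

/-- `ξ ∈ C([0,∞); 𝓗̊^{2,Σ₀}_{tan,3}(Ω)) ∩ C_b([0,∞); H⁴(Σ₀)) ∩ C_b([0,∞); 𝓗̊^{2,Σ₀}_{tan,2}(Ω))`. -/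
def MemDisplacement (b : ℝ) (ξ : ℝ → VF b) : Prop :=
  (∀ t, 0 ≤ t → MemCirc b 3 (ξ t)) ∧ ContIn (circSq b 3) ξ ∧
    BddContIn (surfSq b) ξ ∧ BddContIn (circSq b 2) ξ

/-! ### The Lagrangian system -/

/-- `G i j = ∂ⱼ fⁱ`. -/
def IsGrad (b : ℝ) (f : VF b) (G : Fin 3 → Fin 3 → L2 (slab b)) : Prop :=
  ∀ i j, IsWeakDeriv (slab b) j (f i) (G i j)

/-- `∇·f = 0`. -/
def DivFree (b : ℝ) (f : VF b) : Prop :=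
  ∃ G, IsGrad b f G ∧ ∀ᵐ x ∂(volume.restrict (slab b)), ∑ i, G i i x = 0

/-- The matrix with entries `∂ⱼ fⁱ(x)`, from the family of the functions `∂ⱼ fⁱ`. -/
def mat {X : Type} (G : Fin 3 → Fin 3 → X → ℝ) (x : X) : Matrix (Fin 3) (Fin 3) ℝ :=
  Matrix.of fun i j => G i j x

/-- The Jacobian `J = det (I + Dξ)`. -/
def jac (G : Matrix (Fin 3) (Fin 3) ℝ) : ℝ := (1 + G).det

/-- `𝒜 = (I + Dξ)^{-T}`, with entries `𝒜 i j = 𝒜_i^j`. -/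
def calA (G : Matrix (Fin 3) (Fin 3) ℝ) : Matrix (Fin 3) (Fin 3) ℝ := ((1 + G)⁻¹).transpose

/-- `𝔻_𝒜(v)_{ij} = 𝒜_i^k ∂ₖ vʲ + 𝒜_j^k ∂ₖ vⁱ`, from `G = Dξ` and `V = Dv`. -/
def symGrad (G V : Matrix (Fin 3) (Fin 3) ℝ) : Matrix (Fin 3) (Fin 3) ℝ :=
  Matrix.of fun i j => ∑ k, (calA G i k * V j k + calA G j k * V i k)

/-- `∇_𝒜·v = 𝒜_i^j ∂ⱼ vⁱ`. -/
def divA (G V : Matrix (Fin 3) (Fin 3) ℝ) : ℝ := ∑ i, ∑ j, calA G i j * V i j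

/-- The normal vector `𝒩 = J 𝒜 n₀`, `n₀ = (1, 0, 0)`. -/
def normalVec (G : Matrix (Fin 3) (Fin 3) ℝ) (i : Fin 3) : ℝ := jac G * calA G i 0

/-- The flow map is nondegenerate (so that `𝒜` is defined) and `∇_𝒜·v = 0` in `Ω`. -/
def Incompressible (b : ℝ) (ξ v : VF b) : Prop :=
  ∃ Dξ Dv : Fin 3 → Fin 3 → L2 (slab b), IsGrad b ξ Dξ ∧ IsGrad b v Dv ∧
    ∀ᵐ x ∂(volume.restrict (slab b)),
      jac (mat (fun i j => Dξ i j) x) ≠ 0 ∧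
        divA (mat (fun i j => Dξ i j) x) (mat (fun i j => Dv i j) x) = 0

/-- `F = -∇_𝒜 q + ν ∇_𝒜·𝔻_𝒜(v)` in `Ω`, where `T k i j = ∂ₖ (𝔻_𝒜(v)_{ij})`. -/
def IsForce (b ν : ℝ) (ξ v : VF b) (q : L2 (slab b)) (F : Fin 3 → Eu 3 → ℝ) : Prop :=
  ∃ (Dξ Dv : Fin 3 → Fin 3 → L2 (slab b)) (Dq : Fin 3 → L2 (slab b))
    (T : Fin 3 → Fin 3 → Fin 3 → Eu 3 → ℝ),
    IsGrad b ξ Dξ ∧ IsGrad b v Dv ∧ (∀ j, IsWeakDeriv (slab b) j q (Dq j)) ∧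
    (∀ k i j, IsWeakDeriv (slab b) k
      (fun x => symGrad (mat (fun i j => Dξ i j) x) (mat (fun i j => Dv i j) x) i j) (T k i j)) ∧
    ∀ᵐ x ∂(volume.restrict (slab b)), ∀ i,
      F i x = -(∑ j, calA (mat (fun i j => Dξ i j) x) i j * Dq j x) +
        ν * ∑ j, ∑ k, calA (mat (fun i j => Dξ i j) x) j k * T k i j x

/-- `∂ₜ v = F` in the sense of distributions, `v` being continuous in time. -/
def IsTimeDeriv (b : ℝ) (v : ℝ → VF b) (F : ℝ → Fin 3 → Eu 3 → ℝ) : Prop :=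
  (∀ᵐ t ∂(volume.restrict (Ici (0 : ℝ))), ∀ i, LocallyIntegrableOn (F t i) (slab b)) ∧
    ∀ ψ : Eu 3 → ℝ, IsTest (slab b) ψ → ∀ i, ∀ t, 0 ≤ t →
      IntervalIntegrable (fun τ => ∫ x in slab b, F τ i x * ψ x) volume 0 t ∧
      (∫ x in slab b, v t i x * ψ x) - ∫ x in slab b, v 0 i x * ψ x =
        ∫ τ in (0 : ℝ)..t, ∫ x in slab b, F τ i x * ψ x

/-- `(q - ξ¹) 𝒩 - ν 𝔻_𝒜(v) 𝒩 = 0` on `Σ₀`, in the sense of traces. -/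
def StressCondition (b ν : ℝ) (ξ v : VF b) (q : L2 (slab b)) : Prop :=
  ∃ (Dξ Dv : Fin 3 → Fin 3 → L2 (slab b)) (G V : Fin 3 → Fin 3 → Surf) (h p : Surf),
    IsGrad b ξ Dξ ∧ IsGrad b v Dv ∧
    (∀ i j, IsTraceTop b (Dξ i j) (G i j)) ∧ (∀ i j, IsTraceTop b (Dv i j) (V i j)) ∧
    IsTraceTop b (ξ 0) h ∧ IsTraceTop b q p ∧
    ∀ᵐ y : Eu 2, jac (mat (fun i j => G i j) y) ≠ 0 ∧ ∀ i,
      (p y - h y) * normalVec (mat (fun i j => G i j) y) i -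
        ν * ∑ j, symGrad (mat (fun i j => G i j) y) (mat (fun i j => V i j) y) i j *
          normalVec (mat (fun i j => G i j) y) j = 0

/-- `(ξ, v, q)` solves the viscous surface wave problem in Lagrangian coordinates on `[0, ∞)`,
with initial data `(ξ₀, v₀)`. -/
structure IsSolution (b ν : ℝ) (ξ₀ v₀ : VF b) (ξ v : ℝ → VF b) (q : ℝ → L2 (slab b)) :
    Prop where
  kinematic : ∀ t, 0 ≤ t → ∀ i, HasDerivWithinAt (fun s => ξ s i) (v t i) (Ici 0) t
  momentum : ∃ F : ℝ → Fin 3 → Eu 3 → ℝ, IsTimeDeriv b v F ∧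
    ∀ᵐ t ∂(volume.restrict (Ici (0 : ℝ))), IsForce b ν (ξ t) (v t) (q t) (F t)
  incompressible : ∀ t, 0 ≤ t → Incompressible b (ξ t) (v t)
  stress : ∀ᵐ t ∂(volume.restrict (Ici (0 : ℝ))), StressCondition b ν (ξ t) (v t) (q t)
  noSlip : ∀ t, 0 ≤ t → ∀ j, IsTraceBot b (v t j) 0
  init_ξ : ξ 0 = ξ₀
  init_v : v 0 = v₀

end ViscousSurface

end

noncomputable section

namespace ViscousSurface

/-! The obstruction sits at low horizontal frequencies. Since `ξ(t) = εθ + ∫₀ᵗ v` and the top trace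
of `ξ¹` tends to zero, pairing with a test function `ψ` on `Σ₀` shows that `ε⟨θ¹, ψ⟩` is minus the
limit of `∫₀ᵗ ⟨v¹, ψ⟩`. Insert the expansion of `v`. Each term is bounded uniformly in `t` through
the `L¹`-in-time norm of `Λ̇_h^σ`, so after division by `ε` only `v⁽¹⁾` survives as `ε → 0`.

The nonlinear incompressibility condition linearizes to `∇·v⁽¹⁾ = 0` (`sum_wd_first_order_eq_zero`).
As `v⁽¹⁾` vanishes on `Σ_b`, integration along vertical lines makes the top trace of its first
component minus the horizontal divergence of the vertically integrated horizontal velocity. Hence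
that trace paired with `ψ` equals `∫_Ω v⁽¹⁾_h · ∂_h ψ`. Moving `Λ̇_h^σ` onto `v⁽¹⁾` by duality
(`exists_lambda_dual`) yields `|⟨θ¹, ψ⟩| ≤ C (‖Λ̇_h^{-σ} ∂₂ψ‖ + ‖Λ̇_h^{-σ} ∂₃ψ‖)` with `C`
independent of `ψ`, up to a positive margin in the constant (`enorm_topPairing_le_of_divFree`,
`abs_topPairing_data_le`). So `θ¹` would have to lie in the homogeneous space of order `σ - 1`.

Smooth square integrable data need not. With a bump `ψ ≥ 0` and `r = 2^((σ-1)/2) < 1`, take `θ = (P,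
0, 0)` with `P(y) = ∑ₙ 2⁻ⁿ rⁿ ψ(2⁻ⁿ y)`, a function of `x_h` alone. Tested against `ψ(cy)`, `c =
2⁻ᴺ`, it gives at least `c⁻¹ rᴺ ‖ψ‖²` (`inner_profile_ge`), while the bound is a multiple of `c^(-σ)
= c⁻¹ r²ᴺ` (`lamNorm_pd_comp_smul`). For large `N` this is impossible. -/

/-! ### Fubini's theorem on the slab -/

/-- The horizontal part of a point. -/
def hpart (x : Eu 3) : Eu 2 := !₂[x 1, x 2]

@[simp] lemma pt_zero (s : ℝ) (y : Eu 2) : pt s y 0 = s := rfl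
@[simp] lemma hpart_pt (s : ℝ) (y : Eu 2) : hpart (pt s y) = y := by
  ext i; fin_cases i <;> rfl
lemma pt_hpart (x : Eu 3) : pt (x 0) (hpart x) = x := by
  ext i; fin_cases i <;> rfl
/-- The splitting of `ℝ³` into the vertical axis and the horizontal plane. -/
def ptEquiv : ℝ × Eu 2 ≃ᵐ Eu 3 :=
  (((MeasurableEquiv.refl ℝ).prodCongr (MeasurableEquiv.toLp 2 (Fin 2 → ℝ)).symm).trans
    (MeasurableEquiv.piFinSuccAbove (fun _ : Fin 3 => ℝ) 0).symm).trans
    (MeasurableEquiv.toLp 2 (Fin 3 → ℝ))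

lemma ptEquiv_apply (p : ℝ × Eu 2) : ptEquiv p = pt p.1 p.2 := by
  ext i; fin_cases i <;> rfl

lemma measurePreserving_ptEquiv : MeasurePreserving ptEquiv volume volume := by
  refine (PiLp.volume_preserving_toLp (Fin 3)).comp
    (((volume_preserving_piFinSuccAbove (fun _ : Fin 3 => ℝ) 0).symm _).comp ?_)
  exact (MeasurePreserving.id volume).prod (PiLp.volume_preserving_ofLp (Fin 2))

lemma isOpen_slab (b : ℝ) : IsOpen (slab b) := by
  have h : slab b = (fun x : Eu 3 => x 0) ⁻¹' Ioo (-b) 0 := rfl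
  rw [h]
  exact isOpen_Ioo.preimage (by fun_prop)

lemma measurableSet_slab (b : ℝ) : MeasurableSet (slab b) := (isOpen_slab b).measurableSet

lemma measurePreserving_slab (b : ℝ) : MeasurePreserving ptEquiv
    (((volume : Measure ℝ).restrict (Ioo (-b) 0)).prod (volume : Measure (Eu 2)))
    (volume.restrict (slab b)) := by
  have h := measurePreserving_ptEquiv.restrict_preimage (measurableSet_slab b)
  have e : ptEquiv ⁻¹' slab b = Ioo (-b) 0 ×ˢ univ := by
    ext p; simp [slab, ptEquiv_apply]
  rw [e, Measure.volume_eq_prod, ← Measure.prod_restrict, Measure.restrict_univ] at h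
  exact h

lemma setIntegral_slab {b : ℝ} {F : Eu 3 → ℝ} (hF : IntegrableOn F (slab b)) :
    ∫ x in slab b, F x = ∫ s in Ioo (-b) 0, ∫ y, F (pt s y) := by
  rw [← (measurePreserving_slab b).integral_comp' F]
  rw [integral_prod (fun p => F (ptEquiv p))]
  · simp [ptEquiv_apply]
  · exact ((measurePreserving_slab b).integrable_comp_emb ptEquiv.measurableEmbedding).2 hF

lemma quasiMeasurePreserving_hpart (b : ℝ) :
    Measure.QuasiMeasurePreserving hpart (volume.restrict (slab b)) volume := by
  have h := (Measure.quasiMeasurePreserving_snd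
    (μ := (volume : Measure ℝ).restrict (Ioo (-b) 0)) (ν := (volume : Measure (Eu 2)))).comp
    ((measurePreserving_slab b).symm _).quasiMeasurePreserving
  convert h using 1
  ext x : 1
  have := ptEquiv.apply_symm_apply x
  rw [ptEquiv_apply] at this
  conv_lhs => rw [← this]
  simp

lemma lintegral_slab_mul (b : ℝ) {A : ℝ → ℝ≥0∞} {B : Eu 2 → ℝ≥0∞} (hA : Measurable A)
    (hB : AEMeasurable B) :
    ∫⁻ x in slab b, A (x 0) * B (hpart x) = (∫⁻ s in Ioo (-b) 0, A s) * ∫⁻ y, B y := by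
  rw [← lintegral_prod_mul hA.aemeasurable hB,
    ← (measurePreserving_slab b).lintegral_comp_emb ptEquiv.measurableEmbedding]
  simp [ptEquiv_apply]

/-- Continuity of a function of the vertical variable together with square integrability of a
function of the horizontal one gives a square integrable product. -/
lemma memLp_tens (b : ℝ) {η : ℝ → ℝ} (hη : Continuous η) {P : Eu 2 → ℝ} (hP : MemLp P 2 volume) :
    MemLp (fun x => η (x 0) * P (hpart x)) 2 (volume.restrict (slab b)) := by
  have hm : AEStronglyMeasurable (fun x => η (x 0) * P (hpart x)) (volume.restrict (slab b)) :=
    (by fun_prop : Continuous fun x : Eu 3 => η (x 0)).aestronglyMeasurable.mul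
      (hP.1.comp_quasiMeasurePreserving (quasiMeasurePreserving_hpart b))
  refine ⟨hm, ?_⟩
  rw [eLpNorm_lt_top_iff_lintegral_rpow_enorm_lt_top (by simp) (by simp)]
  have h1 := (eLpNorm_lt_top_iff_lintegral_rpow_enorm_lt_top (by simp) (by simp)).1 hP.2
  simp only [enorm_mul, ENNReal.toReal_ofNat] at h1 ⊢
  simp_rw [ENNReal.mul_rpow_of_nonneg _ _ (by norm_num : (0:ℝ) ≤ 2)]
  rw [lintegral_slab_mul b (A := fun s => ‖η s‖ₑ ^ (2:ℝ)) (B := fun y => ‖P y‖ₑ ^ (2:ℝ))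
    (by fun_prop) (hP.1.enorm.pow_const _)]
  refine ENNReal.mul_lt_top ?_ h1
  obtain ⟨M, hM⟩ := isCompact_Icc.exists_bound_of_continuousOn (s := Icc (-b) 0) hη.continuousOn
  refine (setLIntegral_mono (g := fun _ => (‖M‖ₑ) ^ (2:ℝ)) (by fun_prop) fun s hs => ?_).trans_lt ?_
  · gcongr
    have := hM s (Ioo_subset_Icc_self hs)
    simp only [enorm_le_iff_norm_le]
    exact this.trans (le_abs_self M)
  · simp only [setLIntegral_const, Real.volume_Ioo]
    exact ENNReal.mul_lt_top (by simp) (by simp)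

/-- The function `η(x₁) P(x_h)` as an element of `L²(Ω)`. -/
def tens (b : ℝ) {η : ℝ → ℝ} (hη : Continuous η) (P : Surf) : L2 (slab b) :=
  (memLp_tens b hη (P := P) (by simpa using Lp.memLp P)).toLp _

/-- Square integrable functions on the plane as elements of `Surf`. -/
def toSurf {P : Eu 2 → ℝ} (hP : MemLp P 2 volume) : Surf :=
  MemLp.toLp P (μ := volume.restrict univ) (by simpa using hP)

lemma toSurf_ae {P : Eu 2 → ℝ} (hP : MemLp P 2 volume) : toSurf hP =ᵐ[volume] P := by
  have := MemLp.coeFn_toLp (μ := volume.restrict univ) (f := P) (p := 2) (by simpa using hP)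
  simpa [toSurf] using this

lemma tens_ae (b : ℝ) {η : ℝ → ℝ} (hη : Continuous η) (P : Surf) :
    ∀ᵐ x ∂(volume.restrict (slab b)), tens b hη P x = η (x 0) * P (hpart x) :=
  MemLp.coeFn_toLp _

lemma tens_toSurf_ae (b : ℝ) {η : ℝ → ℝ} (hη : Continuous η) {P : Eu 2 → ℝ}
    (hP : MemLp P 2 volume) :
    ∀ᵐ x ∂(volume.restrict (slab b)), tens b hη (toSurf hP) x = η (x 0) * P (hpart x) := by
  filter_upwards [tens_ae b hη (toSurf hP),
    (quasiMeasurePreserving_hpart b).ae (toSurf_ae hP)] with x h1 h2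
  rw [h1, h2]

lemma inner_eq_integral {n : ℕ} {U : Set (Eu n)} (f u : L2 U) :
    inner ℝ f u = ∫ x in U, u x * f x := by
  rw [L2.inner_def]; rfl

lemma inner_tens (b : ℝ) {η : ℝ → ℝ} (hη : Continuous η) {P : Eu 2 → ℝ}
    (hP : MemLp P 2 volume) (u : L2 (slab b)) :
    inner ℝ (tens b hη (toSurf hP)) u = ∫ x in slab b, u x * (η (x 0) * P (hpart x)) := by
  rw [inner_eq_integral]
  refine integral_congr_ae ?_
  filter_upwards [tens_toSurf_ae b hη hP] with x hx
  rw [hx]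

lemma ae_of_ae_restrict_univ {p : Eu 2 → Prop}
    (h : ∀ᵐ y ∂((volume : Measure (Eu 2)).restrict univ), p y) : ∀ᵐ y : Eu 2, p y := by
  rwa [Measure.restrict_univ] at h

lemma tens_sub (b : ℝ) {η : ℝ → ℝ} (hη : Continuous η) (P Q : Surf) :
    tens b hη (P - Q) = tens b hη P - tens b hη Q := by
  refine Lp.ext ?_
  have hs : ∀ᵐ y : Eu 2, (P - Q : Surf) y = P y - Q y := by
    exact ae_of_ae_restrict_univ (Lp.coeFn_sub P Q)
  filter_upwards [tens_ae b hη (P - Q), tens_ae b hη P, tens_ae b hη Q,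
    Lp.coeFn_sub (tens b hη P) (tens b hη Q),
    (quasiMeasurePreserving_hpart b).ae hs] with x h1 h2 h3 h4 h5
  rw [h4, h1, h5, Pi.sub_apply, h2, h3]; ring

lemma enorm_sq_eq_lintegral {n : ℕ} {U : Set (Eu n)} (u : L2 U) :
    ‖u‖ₑ ^ 2 = ∫⁻ x in U, ‖u x‖ₑ ^ 2 := by
  rw [Lp.enorm_def, eLpNorm_eq_lintegral_rpow_enorm_toReal (by simp) (by simp)]
  simp only [ENNReal.toReal_ofNat, one_div, ← ENNReal.rpow_natCast, ← ENNReal.rpow_mul]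
  norm_num

/-- The norm of `η(x₁) P(x_h)` when `|η| ≤ M`. -/
lemma norm_tens_le {b : ℝ} (hb : 0 ≤ b) {η : ℝ → ℝ} (hη : Continuous η) {M : ℝ} (hM : 0 ≤ M)
    (h : ∀ s ∈ Ioo (-b) 0, |η s| ≤ M) (P : Surf) :
    ‖tens b hη P‖ ≤ M * √b * ‖P‖ := by
  have key : ‖tens b hη P‖ₑ ^ 2 ≤ ENNReal.ofReal (M ^ 2 * b) * ‖P‖ₑ ^ 2 := by
    rw [enorm_sq_eq_lintegral, enorm_sq_eq_lintegral, setLIntegral_univ]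
    have e : ∫⁻ x in slab b, ‖tens b hη P x‖ₑ ^ 2
        = ∫⁻ x in slab b, ‖η (x 0)‖ₑ ^ 2 * ‖P (hpart x)‖ₑ ^ 2 := by
      refine lintegral_congr_ae ?_
      filter_upwards [tens_ae b hη P] with x hx
      rw [hx, enorm_mul, mul_pow]
    have hPm : AEMeasurable (fun y => ‖P y‖ₑ ^ 2) := by
      have := (Lp.aestronglyMeasurable P).enorm.pow_const 2
      simpa using this
    rw [e, lintegral_slab_mul b (A := fun s => ‖η s‖ₑ ^ 2) (B := fun y => ‖P y‖ₑ ^ 2)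
      (by fun_prop) hPm]
    gcongr
    refine (setLIntegral_mono (g := fun _ => ENNReal.ofReal (M ^ 2)) (by fun_prop)
      fun s hs => ?_).trans ?_
    · rw [ENNReal.ofReal_pow hM, ← ofReal_norm]
      gcongr
      exact h s hs
    · simp only [setLIntegral_const, Real.volume_Ioo]
      rw [ENNReal.ofReal_mul (by positivity)]; simp
  have h2 : ‖tens b hη P‖ ^ 2 ≤ (M ^ 2 * b) * ‖P‖ ^ 2 := by
    rw [← ofReal_norm, ← ofReal_norm, ← ENNReal.ofReal_pow (norm_nonneg _),
      ← ENNReal.ofReal_pow (norm_nonneg _), ← ENNReal.ofReal_mul (by positivity)] at key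
    exact (ENNReal.ofReal_le_ofReal_iff (by positivity)).1 key
  refine le_of_sq_le_sq ?_ (by positivity)
  rw [mul_pow, mul_pow, Real.sq_sqrt hb]; exact h2

/-! ### Weak derivatives of square integrable functions -/

lemma contDiff_pd {n : ℕ} {φ : Eu n → ℝ} (h : ContDiff ℝ ∞ φ) (i : Fin n) :
    ContDiff ℝ ∞ (pd i φ) :=
  (h.fderiv_right (m := ∞) (by simp)).clm_apply contDiff_const

lemma hasCompactSupport_pd {n : ℕ} {φ : Eu n → ℝ} (h : HasCompactSupport φ) (i : Fin n) :
    HasCompactSupport (pd i φ) := by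
  have := h.fderiv (𝕜 := ℝ)
  exact this.comp_left (g := fun L : Eu n →L[ℝ] ℝ => L (EuclideanSpace.single i 1)) rfl

lemma tsupport_pd_subset {n : ℕ} (φ : Eu n → ℝ) (i : Fin n) : tsupport (pd i φ) ⊆ tsupport φ := by
  refine closure_minimal (fun x hx => ?_) (isClosed_tsupport φ)
  refine support_fderiv_subset (𝕜 := ℝ) fun h0 => hx ?_
  simp [pd, h0]

lemma IsTest.pd {n : ℕ} {U : Set (Eu n)} {φ : Eu n → ℝ} (h : IsTest U φ) (i : Fin n) :
    IsTest U (pd i φ) :=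
  ⟨contDiff_pd h.1 i, hasCompactSupport_pd h.2.1 i, (tsupport_pd_subset φ i).trans h.2.2⟩

lemma IsTest.memLp {n : ℕ} {U : Set (Eu n)} {φ : Eu n → ℝ} (h : IsTest U φ)
    (p : ℝ≥0∞) (μ : Measure (Eu n)) [IsFiniteMeasureOnCompacts μ] : MemLp φ p μ :=
  h.1.continuous.memLp_of_hasCompactSupport h.2.1

lemma inner_toLp {n : ℕ} {U : Set (Eu n)} {f : Eu n → ℝ} (hf : MemLp f 2 (volume.restrict U))
    (u : L2 U) : inner ℝ (hf.toLp f) u = ∫ x in U, u x * f x := by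
  rw [inner_eq_integral]
  refine integral_congr_ae ?_
  filter_upwards [hf.coeFn_toLp] with x hx
  rw [hx]

lemma locallyIntegrableOn_L2 {n : ℕ} {U : Set (Eu n)} (u : L2 U) : LocallyIntegrableOn u U :=
  locallyIntegrableOn_of_locallyIntegrable_restrict
    ((Lp.memLp u).locallyIntegrable (by norm_num))

/-- A test function as an element of `L²(U)`. -/
def testLp {n : ℕ} {U V : Set (Eu n)} {φ : Eu n → ℝ} (h : IsTest V φ) : L2 U :=
  (h.memLp 2 (volume.restrict U)).toLp φ

lemma inner_testLp {n : ℕ} {U V : Set (Eu n)} {φ : Eu n → ℝ} (h : IsTest V φ) (u : L2 U) :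
    inner ℝ (testLp h) u = ∫ x in U, u x * φ x := inner_toLp _ u

/-- In this form the condition is a family of equalities between continuous linear functionals of
`u` and `w`. Linearity, closedness under limits and commutation with time integrals then become
immediate. -/
lemma isWeakDeriv_iff {n : ℕ} {U : Set (Eu n)} {i : Fin n} {u w : L2 U} :
    IsWeakDeriv U i u w ↔ ∀ (φ : Eu n → ℝ) (h : IsTest U φ),
      inner ℝ (testLp (U := U) (h.pd i)) u = - inner ℝ (testLp (U := U) h) w := by
  simp only [inner_testLp]
  exact ⟨fun h φ hφ => h.2.2 φ hφ,
    fun h => ⟨locallyIntegrableOn_L2 u, locallyIntegrableOn_L2 w, h⟩⟩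

/-- The fundamental lemma of the calculus of variations applied to the difference; it makes `wd`
independent of the choice in its definition. -/
lemma IsWeakDeriv.unique {n : ℕ} {U : Set (Eu n)} (hU : IsOpen U) {i : Fin n} {u : Eu n → ℝ}
    {w w' : L2 U} (h : IsWeakDeriv U i u w) (h' : IsWeakDeriv U i u w') : w = w' := by
  have key : ∀ᵐ x : Eu n, x ∈ U → (w - w' : L2 U) x = 0 := by
    refine hU.ae_eq_zero_of_integral_contDiff_smul_eq_zero (locallyIntegrableOn_L2 (w - w'))
      fun φ h1 h2 h3 => ?_
    have hφ : IsTest U φ := ⟨h1, h2, h3⟩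
    have e : inner ℝ (testLp (U := U) hφ) (w - w') = 0 := by
      rw [inner_sub_right, inner_testLp, inner_testLp]
      have := h.2.2 φ hφ
      have := h'.2.2 φ hφ
      linarith
    rw [inner_testLp, setIntegral_eq_integral_of_forall_compl_eq_zero] at e
    · simpa [mul_comm] using e
    · intro x hx
      rw [image_eq_zero_of_notMem_tsupport (fun hh => hx (h3 hh)), mul_zero]
  rw [← sub_eq_zero]
  refine Lp.ext ?_
  filter_upwards [(ae_restrict_iff' hU.measurableSet).2 key, Lp.coeFn_zero ℝ 2 (volume.restrict U)]
    with x h1 h2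
  rw [h1, h2]; rfl

lemma IsWeakDeriv.sub {n : ℕ} {U : Set (Eu n)} {i : Fin n} {u u' w w' : L2 U}
    (h : IsWeakDeriv U i u w) (h' : IsWeakDeriv U i u' w') :
    IsWeakDeriv U i (u - u' : L2 U) (w - w' : L2 U) := by
  rw [isWeakDeriv_iff] at *
  intro φ hφ
  rw [inner_sub_right, inner_sub_right, h φ hφ, h' φ hφ]; ring

lemma IsWeakDeriv.add {n : ℕ} {U : Set (Eu n)} {i : Fin n} {u u' w w' : L2 U}
    (h : IsWeakDeriv U i u w) (h' : IsWeakDeriv U i u' w') :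
    IsWeakDeriv U i (u + u' : L2 U) (w + w' : L2 U) := by
  rw [isWeakDeriv_iff] at *
  intro φ hφ
  rw [inner_add_right, inner_add_right, h φ hφ, h' φ hφ]; ring

lemma IsWeakDeriv.smul {n : ℕ} {U : Set (Eu n)} {i : Fin n} {u w : L2 U} (c : ℝ)
    (h : IsWeakDeriv U i u w) : IsWeakDeriv U i (c • u : L2 U) (c • w : L2 U) := by
  rw [isWeakDeriv_iff] at *
  intro φ hφ
  rw [inner_smul_right, inner_smul_right, h φ hφ]; ring

lemma isWeakDeriv_zero {n : ℕ} (U : Set (Eu n)) (i : Fin n) :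
    IsWeakDeriv U i (0 : L2 U) (0 : L2 U) := by
  rw [isWeakDeriv_iff]; intro φ hφ; simp

/-- Weak differentiation is a closed operation. -/
lemma IsWeakDeriv.of_tendsto {n : ℕ} {U : Set (Eu n)} {i : Fin n} {ι : Type*} {l : Filter ι}
    [l.NeBot] {u w : ι → L2 U} {u' w' : L2 U} (hu : Tendsto u l (𝓝 u')) (hw : Tendsto w l (𝓝 w'))
    (h : ∀ k, IsWeakDeriv U i (u k) (w k)) : IsWeakDeriv U i u' w' := by
  simp only [isWeakDeriv_iff] at *
  intro φ hφ
  have h1 : Tendsto (fun k => inner ℝ (testLp (U := U) (hφ.pd i)) (u k)) l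
      (𝓝 (inner ℝ (testLp (U := U) (hφ.pd i)) u')) := tendsto_const_nhds.inner hu
  have h2 : Tendsto (fun k => -inner ℝ (testLp (U := U) hφ) (w k)) l
      (𝓝 (-inner ℝ (testLp (U := U) hφ) w')) := (tendsto_const_nhds.inner hw).neg
  exact tendsto_nhds_unique h1 (h2.congr fun k => (h k φ hφ).symm)

open Classical in
/-- The weak derivative `∂ᵢ u ∈ L²(U)` (zero if it does not exist). -/
def wd {n : ℕ} {U : Set (Eu n)} (i : Fin n) (u : L2 U) : L2 U :=
  if h : ∃ w : L2 U, IsWeakDeriv U i u w then h.choose else 0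

lemma IsWeakDeriv.wd_eq {n : ℕ} {U : Set (Eu n)} (hU : IsOpen U) {i : Fin n} {u w : L2 U}
    (h : IsWeakDeriv U i u w) : wd i u = w := by
  have h' : ∃ w : L2 U, IsWeakDeriv U i u w := ⟨w, h⟩
  rw [wd, dif_pos h']
  exact h'.choose_spec.unique hU h

/-! ### Sobolev norms -/

@[simp] lemma onDeriv_nil {n : ℕ} {U : Set (Eu n)} (N : L2 U → ℝ≥0∞) (u : L2 U) :
    onDeriv U [] N u = N u := by
  simp [onDeriv, IsIterDeriv]

lemma enorm_sq_le_sobSq {n : ℕ} (U : Set (Eu n)) (s : ℕ) (u : L2 U) :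
    ‖u‖ₑ ^ 2 ≤ sobSq U s u := by
  unfold sobSq
  have h0 : (0 : ℕ) ∈ Finset.range (s + 1) := by simp
  refine le_trans ?_ (Finset.single_le_sum (f := fun k => ∑ α : Fin k → Fin n,
    onDeriv U (List.ofFn α) (fun w => ‖w‖ₑ ^ 2) u) (fun _ _ => zero_le) h0)
  simp

lemma onDeriv_singleton_le_sobSq {n : ℕ} (U : Set (Eu n)) {s : ℕ} (hs : 1 ≤ s) (i : Fin n)
    (u : L2 U) : onDeriv U [i] (fun w => ‖w‖ₑ ^ 2) u ≤ sobSq U s u := by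
  unfold sobSq
  have h0 : (1 : ℕ) ∈ Finset.range (s + 1) := by simp; omega
  refine le_trans ?_ (Finset.single_le_sum (f := fun k => ∑ α : Fin k → Fin n,
    onDeriv U (List.ofFn α) (fun w => ‖w‖ₑ ^ 2) u) (fun _ _ => zero_le) h0)
  refine le_trans ?_ (Finset.single_le_sum (f := fun α : Fin 1 → Fin n =>
    onDeriv U (List.ofFn α) (fun w => ‖w‖ₑ ^ 2) u) (fun _ _ => zero_le)
    (Finset.mem_univ (fun _ => i)))
  simp

/-- An infimum over an empty set of candidates is `∞`, so finiteness of the norm already produces a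
weak derivative. -/
lemma isWeakDeriv_wd_of_sobSq_lt_top {n : ℕ} {U : Set (Eu n)} (hU : IsOpen U) {s : ℕ}
    (hs : 1 ≤ s) (i : Fin n) {u : L2 U} (h : sobSq U s u < ⊤) : IsWeakDeriv U i u (wd i u) := by
  have h1 := (onDeriv_singleton_le_sobSq U hs i u).trans_lt h
  simp only [onDeriv, iInf_lt_iff] at h1
  obtain ⟨w, ⟨z, rfl, hw⟩, -⟩ := h1
  rwa [hw.wd_eq hU]

lemma enorm_wd_sq_le_sobSq {n : ℕ} {U : Set (Eu n)} (hU : IsOpen U) {s : ℕ}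
    (hs : 1 ≤ s) (i : Fin n) (u : L2 U) : ‖wd i u‖ₑ ^ 2 ≤ sobSq U s u := by
  refine le_trans ?_ (onDeriv_singleton_le_sobSq U hs i u)
  refine le_iInf₂ fun w hw => ?_
  obtain ⟨z, rfl, hw⟩ := hw
  rw [hw.wd_eq hU]

lemma sobSq_le_tanSq (b : ℝ) (s N : ℕ) (u : L2 (slab b)) :
    sobSq (slab b) s u ≤ tanSq b s N u := by
  unfold tanSq
  have h0 : (0 : ℕ) ∈ Finset.range (N + 1) := by simp
  refine le_trans ?_ (Finset.single_le_sum (f := fun i => ∑ β : Fin i → Fin 2,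
    onDeriv (slab b) (hor β) (sobSq (slab b) s) u) (fun _ _ => zero_le) h0)
  simp [hor]

lemma tanSq_le_tanSqV (b : ℝ) (s N : ℕ) (f : VF b) (j : Fin 3) :
    tanSq b s N (f j) ≤ tanSqV b s N f :=
  Finset.single_le_sum (f := fun j => tanSq b s N (f j)) (fun _ _ => zero_le) (Finset.mem_univ j)

lemma sobSq_le_tanSqV (b : ℝ) (s N : ℕ) (f : VF b) (j : Fin 3) :
    sobSq (slab b) s (f j) ≤ tanSqV b s N f :=
  (sobSq_le_tanSq b s N (f j)).trans (tanSq_le_tanSqV b s N f j)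

/-! ### Negative powers of `|ς_h|` -/

open FourierTransform in
/-- The symbol `|ς|^{-σ} ψ̂` of `Λ̇_h^{-σ} ψ`. -/
def lamSymbol (σ : ℝ) (ψ : Eu 2 → ℝ) (ζ : Eu 2) : ℂ :=
  (((2 * Real.pi * ‖ζ‖) ^ (-σ) : ℝ) : ℂ) * 𝓕 (fun y => (ψ y : ℂ)) ζ

/-- A test function as a complex Schwartz function. -/
def testSchwartz {ψ : Eu 2 → ℝ} (h : IsTest univ ψ) : SchwartzMap (Eu 2) ℂ :=
  HasCompactSupport.toSchwartzMap (f := fun y => (ψ y : ℂ))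
    (h.2.1.comp_left (g := fun r : ℝ => (r : ℂ)) rfl) (Complex.ofRealCLM.contDiff.comp h.1)

-- In polar coordinates of the plane the squared symbol is at most a multiple of `r^(1-2σ)` near the
-- origin, integrable because `σ < 1`. At infinity the quadratic decay of the Schwartz function `ψ̂`
-- leaves `r^(-3-2σ)`.
open FourierTransform in
lemma memLp_lamSymbol {σ : ℝ} (hσ : 0 < σ) (hσ1 : σ < 1) {ψ : Eu 2 → ℝ} (h : IsTest univ ψ) :
    MemLp (lamSymbol σ ψ) 2 volume := by
  set Φ : SchwartzMap (Eu 2) ℂ := 𝓕 (testSchwartz h) with hΦ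
  have hcoe : ∀ ζ, 𝓕 (fun y => (ψ y : ℂ)) ζ = Φ ζ := by
    intro ζ; rw [hΦ, SchwartzMap.fourier_coe]; rfl
  obtain ⟨C, hC, hdec⟩ := Φ.decay 2 0
  obtain ⟨C', hC', hbd⟩ := Φ.decay 0 0
  simp only [norm_iteratedFDeriv_zero, pow_zero, one_mul] at hdec hbd
  have hmeas : AEStronglyMeasurable (lamSymbol σ ψ) volume := by
    have : lamSymbol σ ψ = fun ζ => (((2 * Real.pi * ‖ζ‖) ^ (-σ) : ℝ) : ℂ) * Φ ζ := by
      ext ζ; rw [lamSymbol, hcoe]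
    rw [this]
    refine AEStronglyMeasurable.mul ?_ Φ.continuous.aestronglyMeasurable
    exact (by fun_prop : Measurable fun ζ : Eu 2 =>
      (((2 * Real.pi * ‖ζ‖) ^ (-σ) : ℝ) : ℂ)).aestronglyMeasurable
  rw [memLp_two_iff_integrable_sq_norm hmeas]
  set f : ℝ → ℝ := fun r => (2 * Real.pi * r) ^ (-(2 * σ)) * (if r ≤ 1 then C' ^ 2 else (C * r⁻¹ ^ 2) ^ 2)
    with hf
  have hint : Integrable (fun ζ : Eu 2 => f ‖ζ‖) volume := by
    rw [integrable_fun_norm_addHaar]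
    simp only [finrank_euclideanSpace, Fintype.card_fin, smul_eq_mul, Nat.add_one_sub_one, pow_one]
    rw [← Ioc_union_Ioi_eq_Ioi (zero_le_one (α := ℝ))]
    refine IntegrableOn.union ?_ ?_
    · have h1 : IntegrableOn (fun r : ℝ => ((2 * Real.pi) ^ (-(2 * σ)) * C' ^ 2) * r ^ (1 - 2 * σ))
          (Ioc 0 1) := by
        refine Integrable.const_mul ?_ _
        have := (intervalIntegral.intervalIntegrable_rpow' (a := 0) (b := 1) (r := 1 - 2 * σ)
          (by linarith))
        rwa [intervalIntegrable_iff_integrableOn_Ioc_of_le zero_le_one] at this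
      refine h1.congr_fun (fun r hr => ?_) measurableSet_Ioc
      simp only [hf, if_pos hr.2]
      rw [Real.mul_rpow (by positivity) hr.1.le, sub_eq_add_neg, Real.rpow_add hr.1, Real.rpow_one]
      ring
    · have h1 : IntegrableOn (fun r : ℝ => ((2 * Real.pi) ^ (-(2 * σ)) * C ^ 2) * r ^ (-3 - 2 * σ))
          (Ioi 1) := by
        refine Integrable.const_mul ?_ _
        exact integrableOn_Ioi_rpow_of_lt (by linarith) one_pos
      refine h1.congr_fun (fun r hr => ?_) measurableSet_Ioi
      have hr1 : (1 : ℝ) < r := hr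
      have hr0 : 0 < r := by linarith
      simp only [hf, if_neg (not_le.2 hr1)]
      rw [Real.mul_rpow (by positivity) hr0.le, sub_eq_add_neg, Real.rpow_add hr0,
        Real.rpow_neg hr0.le 3]
      norm_cast
      field_simp
  refine hint.mono' (hmeas.norm.pow 2) (ae_of_all _ fun ζ => ?_)
  rw [Real.norm_of_nonneg (by positivity), lamSymbol, norm_mul, hcoe, mul_pow, hf]
  have e : ‖(((2 * Real.pi * ‖ζ‖) ^ (-σ) : ℝ) : ℂ)‖ ^ 2 = (2 * Real.pi * ‖ζ‖) ^ (-(2 * σ)) := by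
    rw [Complex.norm_real, Real.norm_of_nonneg (by positivity), ← Real.rpow_natCast,
      ← Real.rpow_mul (by positivity)]
    congr 1; push_cast; ring
  rw [e]
  refine mul_le_mul_of_nonneg_left ?_ (by positivity)
  split_ifs with hle
  · exact pow_le_pow_left₀ (norm_nonneg _) (hbd ζ) 2
  · refine pow_le_pow_left₀ (norm_nonneg _) ?_ 2
    have h0 : 0 < ‖ζ‖ := by linarith
    have := hdec ζ
    rw [inv_pow, ← div_eq_mul_inv, le_div_iff₀ (by positivity)]
    linarith

/-! ### Scaling of the negative norm under dilations. -/

/-- The norm of `Λ̇_h^{-σ} ψ` in `L²`. -/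
def lamNorm (σ : ℝ) (ψ : Eu 2 → ℝ) : ℝ := (eLpNorm (lamSymbol σ ψ) 2 volume).toReal

lemma eLpNorm_comp_smul {E : Type*} [NormedAddCommGroup E] {f : Eu 2 → E} {c : ℝ} (hc : 0 < c) :
    eLpNorm (fun y => f (c • y)) 2 volume = ENNReal.ofReal c⁻¹ * eLpNorm f 2 volume := by
  have hemb : MeasurableEmbedding (fun y : Eu 2 => c • y) :=
    (Homeomorph.smulOfNeZero c hc.ne').measurableEmbedding
  have h : eLpNorm f 2 (Measure.map (fun y : Eu 2 => c • y) volume)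
      = eLpNorm (fun y => f (c • y)) 2 volume := hemb.eLpNorm_map_measure
  rw [Measure.map_addHaar_smul _ hc.ne', eLpNorm_smul_measure_of_ne_top (by simp)] at h
  rw [← h]
  simp only [finrank_euclideanSpace, Fintype.card_fin, smul_eq_mul]
  congr 1
  rw [abs_of_pos (by positivity), ENNReal.ofReal_rpow_of_pos (by positivity)]
  congr 1
  rw [← inv_pow, ← Real.rpow_natCast, ← Real.rpow_mul (by positivity)]
  norm_num

-- The transform of the dilate is `c⁻² ψ̂(ζ/c)`, the symbol contributes `c^(-σ)`, and the planar
-- change of variables contributes `c` to the `L²` norm.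
open FourierTransform in
lemma lamNorm_comp_smul (σ : ℝ) (ψ : Eu 2 → ℝ) {c : ℝ} (hc : 0 < c) :
    lamNorm σ (fun y => ψ (c • y)) = c ^ (-1 - σ) * lamNorm σ ψ := by
  have hF : ∀ ζ, 𝓕 (fun y => (ψ (c • y) : ℂ)) ζ
      = ((c ^ 2)⁻¹ : ℝ) * 𝓕 (fun y => (ψ y : ℂ)) (c⁻¹ • ζ) := by
    intro ζ
    rw [Real.fourier_eq, Real.fourier_eq]
    have := Measure.integral_comp_smul (volume : Measure (Eu 2))
      (fun v : Eu 2 => Real.fourierChar (-inner ℝ v (c⁻¹ • ζ)) • (ψ v : ℂ)) c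
    simp only [finrank_euclideanSpace, Fintype.card_fin] at this
    rw [abs_of_pos (by positivity)] at this
    rw [← Complex.real_smul, ← this]
    congr 1
    ext v
    rw [inner_smul_left, inner_smul_right]
    simp [hc.ne']
  have hS : lamSymbol σ (fun y => ψ (c • y)) =
      fun ζ => ((c ^ (-2 - σ) : ℝ) : ℂ) • lamSymbol σ ψ (c⁻¹ • ζ) := by
    ext ζ
    have e : (2 * Real.pi * ‖ζ‖) ^ (-σ) * (c ^ 2)⁻¹
        = c ^ (-2 - σ) * (2 * Real.pi * ‖c⁻¹ • ζ‖) ^ (-σ) := by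
      have e1 : 2 * Real.pi * ‖ζ‖ = c * (2 * Real.pi * ‖c⁻¹ • ζ‖) := by
        rw [norm_smul, Real.norm_of_nonneg (by positivity)]; field_simp
      rw [e1, Real.mul_rpow hc.le (by positivity), sub_eq_add_neg, Real.rpow_add hc,
        Real.rpow_neg hc.le 2]
      norm_cast
      ring
    simp only [lamSymbol, hF, smul_eq_mul]
    rw [← mul_assoc, ← mul_assoc, ← Complex.ofReal_mul, e, Complex.ofReal_mul]
  rw [lamNorm, lamNorm, hS]
  rw [show (fun ζ => ((c ^ (-2 - σ) : ℝ) : ℂ) • lamSymbol σ ψ (c⁻¹ • ζ)) =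
    ((c ^ (-2 - σ) : ℝ) : ℂ) • (fun ζ => lamSymbol σ ψ (c⁻¹ • ζ)) from rfl, eLpNorm_const_smul,
    eLpNorm_comp_smul (inv_pos.2 hc), inv_inv, ENNReal.toReal_mul, ENNReal.toReal_mul,
    ENNReal.toReal_ofReal hc.le]
  simp only [toReal_enorm, Complex.norm_real]
  rw [Real.norm_of_nonneg (by positivity), ← mul_assoc, show -1 - σ = (-2 - σ) + 1 by ring,
    Real.rpow_add hc, Real.rpow_one]

lemma lamNorm_const_mul (σ : ℝ) (ψ : Eu 2 → ℝ) {c : ℝ} (hc : 0 ≤ c) :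
    lamNorm σ (fun y => c * ψ y) = c * lamNorm σ ψ := by
  have hS : lamSymbol σ (fun y => c * ψ y) = (c : ℂ) • lamSymbol σ ψ := by
    ext ζ
    simp only [lamSymbol, Pi.smul_apply, smul_eq_mul, Real.fourier_eq, Complex.ofReal_mul]
    rw [mul_left_comm (c : ℂ), ← integral_const_mul (c : ℂ)]
    congr 2
    funext v
    simp only [Circle.smul_def, smul_eq_mul]; ring
  rw [lamNorm, hS, eLpNorm_const_smul, ENNReal.toReal_mul, lamNorm]
  simp [abs_of_nonneg hc]

lemma memLp_of_memLp_univ {E : Type*} [NormedAddCommGroup E] {f : Eu 2 → E}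
    (h : MemLp f 2 ((volume : Measure (Eu 2)).restrict univ)) : MemLp f 2 volume := by
  rwa [Measure.restrict_univ] at h

/-! ### Duality between `Λ̇_h^σ` and `Λ̇_h^{-σ}` on horizontal slices. -/

open FourierTransform ComplexConjugate in
/-- Pairing with `ψ` before `Λ̇_h^σ` is pairing with `Λ̇_h^{-σ} ψ` after it. -/
theorem exists_lambda_dual {σ : ℝ} (hσ : 0 < σ) (hσ1 : σ < 1) {ψ : Eu 2 → ℝ}
    (h : IsTest univ ψ) :
    ∃ P : Surf, ‖P‖ ≤ lamNorm σ ψ ∧ ∀ (b : ℝ) (u g : L2 (slab b)), IsHorizLambda b σ u g →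
      ∀ (η : ℝ → ℝ) (hη : Continuous η),
        inner ℝ (tens b hη (toSurf (h.memLp 2 volume))) u = inner ℝ (tens b hη P) g := by
  set m : Lp ℂ 2 (volume : Measure (Eu 2)) := (memLp_lamSymbol hσ hσ1 h).toLp _ with hm
  -- `Q` is `Λ̇_h^{-σ} ψ`. Its real part suffices as the dual function, since `u`, `g` and `ψ` are
  -- real; no proof that `Q` itself is real is needed.
  set Q : Lp ℂ 2 (volume : Measure (Eu 2)) := (Lp.fourierTransformₗᵢ (Eu 2) ℂ).symm m with hQ
  have hFQ : Lp.fourierTransformₗᵢ (Eu 2) ℂ Q = m := by rw [hQ]; simp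
  have hre : MemLp (fun y => (Q y).re) 2 volume := (Lp.memLp Q).re
  refine ⟨toSurf hre, ?_, ?_⟩
  · have h1 : ‖toSurf hre‖ = (eLpNorm (fun y => (Q y).re) 2 volume).toReal := by
      rw [toSurf, Lp.norm_toLp, Measure.restrict_univ]
    rw [h1]
    have h2 : (eLpNorm (fun y => (Q y).re) 2 volume).toReal ≤ ‖Q‖ := by
      rw [Lp.norm_def]
      refine ENNReal.toReal_mono (Lp.eLpNorm_ne_top Q) (eLpNorm_mono fun y => ?_)
      exact Complex.abs_re_le_norm _
    refine h2.trans (le_of_eq ?_)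
    rw [hQ, LinearIsometryEquiv.norm_map, hm, Lp.norm_toLp]; rfl
  · intro b u g hug η hη
    have hψL : MemLp ψ 2 volume := h.memLp 2 volume
    -- the identity on almost every slice
    have slice_eq : ∀ᵐ s ∂(volume.restrict (Ioo (-b) 0)),
        ∫ y, u (pt s y) * ψ y = ∫ y, g (pt s y) * (Q y).re := by
      filter_upwards [hug] with s hs
      obtain ⟨hu, hg, hF⟩ := hs
      set Ψ : Lp ℂ 2 (volume : Measure (Eu 2)) := (testSchwartz h).toLp 2 with hΨ
      have hFΨ : Lp.fourierTransformₗᵢ (Eu 2) ℂ Ψ = (𝓕 (testSchwartz h)).toLp 2 :=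
        SchwartzMap.toLp_fourier_eq (testSchwartz h)
      -- Plancherel on both sides: the factors `|ς|^σ` and `|ς|^(-σ)` cancel away from `ζ = 0`, a
      -- null set that must be removed because there the product is not `1`.
      have hin : inner ℂ Ψ (hu.toLp _) = inner ℂ Q (hg.toLp _) := by
        rw [← (Lp.fourierTransformₗᵢ (Eu 2) ℂ).inner_map_map Ψ,
          ← (Lp.fourierTransformₗᵢ (Eu 2) ℂ).inner_map_map Q, hFQ, hFΨ, L2.inner_def, L2.inner_def]
        refine integral_congr_ae ?_
        have hne : ∀ᵐ ζ : Eu 2, ζ ≠ 0 := by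
          simp [ae_iff, measure_singleton]
        filter_upwards [hF, hne, (memLp_lamSymbol hσ hσ1 h).coeFn_toLp,
          (𝓕 (testSchwartz h)).coeFn_toLp 2 volume] with ζ h1 h2 h3 h4
        rw [h1, h3, h4, lamSymbol]
        have hc : (𝓕 (testSchwartz h)) ζ = 𝓕 (fun y => (ψ y : ℂ)) ζ := by
          rw [SchwartzMap.fourier_coe]; rfl
        rw [hc]
        have hp : (0 : ℝ) < 2 * Real.pi * ‖ζ‖ := by
          have := norm_pos_iff.2 h2; positivity
        have hpp : (((2 * Real.pi * ‖ζ‖) ^ σ : ℝ) : ℂ) * (((2 * Real.pi * ‖ζ‖) ^ (-σ) : ℝ) : ℂ)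
            = 1 := by
          rw [← Complex.ofReal_mul, ← Real.rpow_add hp]; simp
        simp only [RCLike.inner_apply, map_mul, Complex.conj_ofReal]
        linear_combination (-(Lp.fourierTransformₗᵢ (Eu 2) ℂ (hu.toLp _) ζ
          * conj (𝓕 (fun y => (ψ y : ℂ)) ζ))) * hpp
      have e1 : inner ℂ Ψ (hu.toLp _) = ∫ y, ((u (pt s y) * ψ y : ℝ) : ℂ) := by
        rw [L2.inner_def]
        refine integral_congr_ae ?_
        filter_upwards [hu.coeFn_toLp, (testSchwartz h).coeFn_toLp 2 volume] with y h1 h2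
        rw [h1, hΨ, h2, show testSchwartz h y = (ψ y : ℂ) from rfl]
        simp [slice, RCLike.inner_apply]
      have hint : Integrable (fun y => conj (Q y) * slice g s y) volume := by
        have h1 : MemLp (fun y => conj (Q y)) 2 volume := (Lp.memLp Q).star
        exact h1.integrable_mul hg
      have e2 : (inner ℂ Q (hg.toLp _)).re = ∫ y, g (pt s y) * (Q y).re := by
        have e3 : inner ℂ Q (hg.toLp _) = ∫ y, conj (Q y) * slice g s y := by
          rw [L2.inner_def]
          refine integral_congr_ae ?_
          filter_upwards [hg.coeFn_toLp] with y h1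
          rw [h1, RCLike.inner_apply, mul_comm]
        rw [e3]
        have := (integral_re hint).symm
        simp only [RCLike.re_to_complex] at this
        rw [this]
        refine integral_congr_ae (ae_of_all _ fun y => ?_)
        simp [slice, mul_comm]
      rw [← e2, ← hin, e1, integral_complex_ofReal, Complex.ofReal_re]
    rw [inner_tens, inner_tens]
    have i1 : IntegrableOn (fun x => u x * (η (x 0) * ψ (hpart x))) (slab b) :=
      (Lp.memLp u).integrable_mul (memLp_tens b hη hψL)
    have i2 : IntegrableOn (fun x => g x * (η (x 0) * (Q (hpart x)).re)) (slab b) :=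
      (Lp.memLp g).integrable_mul (memLp_tens b hη hre)
    rw [setIntegral_slab i1, setIntegral_slab i2]
    refine integral_congr_ae ?_
    filter_upwards [slice_eq] with s hs
    simp only [pt_zero, hpart_pt]
    calc ∫ y, u (pt s y) * (η s * ψ y) = η s * ∫ y, u (pt s y) * ψ y := by
          rw [← integral_const_mul]; congr 1; ext y; ring
      _ = η s * ∫ y, g (pt s y) * (Q y).re := by rw [hs]
      _ = _ := by rw [← integral_const_mul]; congr 1; ext y; ring

/-! ### Product test functions -/

/-- The horizontal part as a continuous linear map. -/
def hpartL : Eu 3 →L[ℝ] Eu 2 :=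
  LinearMap.toContinuousLinearMap
    { toFun := hpart
      map_add' := fun x y => by ext i; fin_cases i <;> rfl
      map_smul' := fun c x => by ext i; fin_cases i <;> rfl }

@[simp] lemma hpartL_apply (x : Eu 3) : hpartL x = hpart x := rfl

lemma hpart_single_zero : hpart (EuclideanSpace.single 0 1) = 0 := by
  ext i; fin_cases i <;> simp [hpart]

lemma hpart_single_succ (j : Fin 2) :
    hpart (EuclideanSpace.single j.succ 1) = EuclideanSpace.single j 1 := by
  ext i; fin_cases i <;> fin_cases j <;> simp [hpart]

lemma fderiv_prod_apply {η : ℝ → ℝ} {ψ : Eu 2 → ℝ} (hη : ContDiff ℝ ∞ η) (hψ : ContDiff ℝ ∞ ψ)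
    (x v : Eu 3) : fderiv ℝ (fun x : Eu 3 => η (x 0) * ψ (hpart x)) x v =
      deriv η (x 0) * v 0 * ψ (hpart x) + η (x 0) * fderiv ℝ ψ (hpart x) (hpart v) := by
  have h1 : HasFDerivAt (fun x : Eu 3 => η (x 0))
      (deriv η (x 0) • (EuclideanSpace.proj (𝕜 := ℝ) (0 : Fin 3) : Eu 3 →L[ℝ] ℝ)) x := by
    have := (hη.differentiable (by simp) (x 0)).hasDerivAt
    exact this.comp_hasFDerivAt x (EuclideanSpace.proj (𝕜 := ℝ) (0 : Fin 3)).hasFDerivAt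
  have h2 : HasFDerivAt (fun x : Eu 3 => ψ (hpart x)) ((fderiv ℝ ψ (hpart x)).comp hpartL) x := by
    have := (hψ.differentiable (by simp) (hpart x)).hasFDerivAt
    exact HasFDerivAt.comp x (f := hpartL) this hpartL.hasFDerivAt
  rw [(h1.fun_mul h2).fderiv]
  simp
  ring

lemma pd_zero_prod {η : ℝ → ℝ} {ψ : Eu 2 → ℝ} (hη : ContDiff ℝ ∞ η) (hψ : ContDiff ℝ ∞ ψ) :
    pd 0 (fun x : Eu 3 => η (x 0) * ψ (hpart x)) = fun x => deriv η (x 0) * ψ (hpart x) := by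
  ext x
  rw [pd, fderiv_prod_apply hη hψ, hpart_single_zero]
  simp

lemma pd_succ_prod {η : ℝ → ℝ} {ψ : Eu 2 → ℝ} (hη : ContDiff ℝ ∞ η) (hψ : ContDiff ℝ ∞ ψ)
    (j : Fin 2) : pd j.succ (fun x : Eu 3 => η (x 0) * ψ (hpart x))
      = fun x => η (x 0) * pd j ψ (hpart x) := by
  ext x
  rw [pd, fderiv_prod_apply hη hψ, hpart_single_succ, pd]
  simp [Fin.succ_ne_zero]

/-- The product of test functions in the vertical and the horizontal variables. -/
lemma isTest_prod {η : ℝ → ℝ} {ψ : Eu 2 → ℝ} {I : Set ℝ} (hη : ContDiff ℝ ∞ η)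
    (hc : HasCompactSupport η) (hI : tsupport η ⊆ I) (hψ : IsTest univ ψ) :
    IsTest {x : Eu 3 | x 0 ∈ I} (fun x : Eu 3 => η (x 0) * ψ (hpart x)) := by
  have hpc : Continuous hpart := hpartL.continuous
  have c0 : Continuous (fun x : Eu 3 => x 0) := by fun_prop
  have hsub : Function.support (fun x : Eu 3 => η (x 0) * ψ (hpart x)) ⊆
      (fun x : Eu 3 => x 0) ⁻¹' tsupport η ∩ hpart ⁻¹' tsupport ψ := by
    intro x hx
    have hx' : η (x 0) * ψ (hpart x) ≠ 0 := hx
    exact ⟨subset_tsupport _ (left_ne_zero_of_mul hx'),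
      subset_tsupport _ (right_ne_zero_of_mul hx')⟩
  have hcl : tsupport (fun x : Eu 3 => η (x 0) * ψ (hpart x)) ⊆
      (fun x : Eu 3 => x 0) ⁻¹' tsupport η ∩ hpart ⁻¹' tsupport ψ :=
    closure_minimal hsub (((isClosed_tsupport η).preimage c0).inter
      ((isClosed_tsupport ψ).preimage hpc))
  refine ⟨?_, ?_, fun x hx => hI (hcl hx).1⟩
  · exact (hη.comp (EuclideanSpace.proj (𝕜 := ℝ) (0 : Fin 3) : Eu 3 →L[ℝ] ℝ).contDiff).mul
      (hψ.1.comp hpartL.contDiff)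
  · have hK : IsCompact ((fun p : ℝ × Eu 2 => pt p.1 p.2) '' (tsupport η ×ˢ tsupport ψ)) := by
      refine (hc.isCompact.prod hψ.2.1.isCompact).image ?_
      unfold pt; fun_prop
    refine hK.of_isClosed_subset (isClosed_tsupport _) fun x hx => ?_
    exact ⟨(x 0, hpart x), ⟨(hcl hx).1, (hcl hx).2⟩, pt_hpart x⟩

lemma IsWeakDeriv.inner_tens_zero {b : ℝ} {u w : L2 (slab b)} (h : IsWeakDeriv (slab b) 0 u w)
    {η : ℝ → ℝ} (hη : ContDiff ℝ ∞ η) (hc : HasCompactSupport η) (hI : tsupport η ⊆ Ioo (-b) 0)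
    {ψ : Eu 2 → ℝ} (hψ : IsTest univ ψ) :
    inner ℝ (tens b (hη.continuous_deriv (by simp)) (toSurf (hψ.memLp 2 volume))) u =
      - inner ℝ (tens b hη.continuous (toSurf (hψ.memLp 2 volume))) w := by
  rw [inner_tens, inner_tens]
  have := h.2.2 _ (isTest_prod hη hc hI hψ)
  rwa [pd_zero_prod hη hψ.1] at this

lemma IsWeakDeriv.inner_tens_succ {b : ℝ} {j : Fin 2} {u w : L2 (slab b)}
    (h : IsWeakDeriv (slab b) j.succ u w)
    {η : ℝ → ℝ} (hη : ContDiff ℝ ∞ η) (hc : HasCompactSupport η) (hI : tsupport η ⊆ Ioo (-b) 0)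
    {ψ : Eu 2 → ℝ} (hψ : IsTest univ ψ) :
    inner ℝ (tens b hη.continuous (toSurf ((hψ.pd j).memLp 2 volume))) u =
      - inner ℝ (tens b hη.continuous (toSurf (hψ.memLp 2 volume))) w := by
  rw [inner_tens, inner_tens]
  have := h.2.2 _ (isTest_prod hη hc hI hψ)
  rwa [pd_succ_prod hη hψ.1] at this

lemma continuous_tens {b : ℝ} (hb : 0 ≤ b) {η : ℝ → ℝ} (hη : Continuous η) :
    Continuous (tens b hη) := by
  obtain ⟨M, hM⟩ := isCompact_Icc.exists_bound_of_continuousOn (s := Icc (-b) 0) hη.continuousOn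
  have h0 : 0 ≤ |M| * √b := by positivity
  refine LipschitzWith.continuous (K := ⟨|M| * √b, h0⟩) (LipschitzWith.of_dist_le_mul fun P Q => ?_)
  rw [dist_eq_norm, dist_eq_norm, ← tens_sub]
  refine norm_tens_le hb hη (abs_nonneg M) (fun s hs => ?_) _
  exact (hM s (Ioo_subset_Icc_self hs)).trans (le_abs_self M)

lemma dense_test_surf :
    Dense {P : Surf | ∃ (ψ : Eu 2 → ℝ) (h : IsTest univ ψ), P = toSurf (h.memLp 2 volume)} := by
  rw [Metric.dense_iff]
  intro P r hr
  obtain ⟨g, h1, h2, h3⟩ := (Lp.memLp P).exist_eLpNorm_sub_le (by simp) (by norm_num)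
    (half_pos hr)
  have hg : IsTest univ g := ⟨h2, h1, subset_univ _⟩
  refine ⟨toSurf (hg.memLp 2 volume), ?_, g, hg, rfl⟩
  rw [Metric.mem_ball, dist_comm, dist_eq_norm, Lp.norm_def]
  have e : eLpNorm (P - toSurf (hg.memLp 2 volume) : Surf) 2 (volume.restrict univ)
      = eLpNorm ((P : Eu 2 → ℝ) - g) 2 (volume.restrict univ) := by
    refine eLpNorm_congr_ae ?_
    have := MemLp.coeFn_toLp (μ := volume.restrict univ) (f := g) (p := 2)
      (by simpa using hg.memLp 2 volume)
    filter_upwards [Lp.coeFn_sub P (toSurf (hg.memLp 2 volume)), this] with x h4 h5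
    rw [h4, Pi.sub_apply, Pi.sub_apply, toSurf, h5]
  rw [e]
  calc _ ≤ (ENNReal.ofReal (r / 2)).toReal := ENNReal.toReal_mono (by simp) h3
    _ < r := by rw [ENNReal.toReal_ofReal (by positivity)]; linarith

/-- The dual function `Λ̇_h^{-σ} ψ` need not be a test function, so vertical integration by parts is
needed with an arbitrary `L²` horizontal factor. Both sides are continuous in `P`, and test
functions are dense. -/
lemma IsWeakDeriv.inner_tens_zero_surf {b : ℝ} (hb : 0 ≤ b) {u w : L2 (slab b)}
    (h : IsWeakDeriv (slab b) 0 u w)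
    {η : ℝ → ℝ} (hη : ContDiff ℝ ∞ η) (hc : HasCompactSupport η) (hI : tsupport η ⊆ Ioo (-b) 0)
    (P : Surf) :
    inner ℝ (tens b (hη.continuous_deriv (by simp)) P) u =
      - inner ℝ (tens b hη.continuous P) w := by
  refine dense_test_surf.induction (P := fun P => inner ℝ (tens b (hη.continuous_deriv (by simp)) P) u =
      - inner ℝ (tens b hη.continuous P) w) ?_ ?_ P
  · rintro _ ⟨ψ, hψ, rfl⟩
    exact h.inner_tens_zero hη hc hI hψ
  · exact isClosed_eq ((continuous_tens hb _).inner continuous_const)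
      (((continuous_tens hb _).inner continuous_const).neg)

/-! ### Removing the compact support in the vertical variable. -/

/-- Smooth cut-off functions exhausting the interval `(-b, 0)`. -/
def vcut (b : ℝ) (k : ℕ) (s : ℝ) : ℝ :=
  Real.smoothTransition (k * (s + b) - 1) * Real.smoothTransition (-k * s - 1)

lemma contDiff_vcut (b : ℝ) (k : ℕ) : ContDiff ℝ ∞ (vcut b k) := by
  unfold vcut
  exact (Real.smoothTransition.contDiff.comp (by fun_prop)).mul
    (Real.smoothTransition.contDiff.comp (by fun_prop))

lemma vcut_nonneg (b : ℝ) (k : ℕ) (s : ℝ) : 0 ≤ vcut b k s :=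
  mul_nonneg (Real.smoothTransition.nonneg _) (Real.smoothTransition.nonneg _)

lemma vcut_le_one (b : ℝ) (k : ℕ) (s : ℝ) : vcut b k s ≤ 1 :=
  mul_le_one₀ (Real.smoothTransition.le_one _) (Real.smoothTransition.nonneg _)
    (Real.smoothTransition.le_one _)

lemma tsupport_vcut (b : ℝ) {k : ℕ} (hk : 0 < k) :
    tsupport (vcut b k) ⊆ Icc (-b + (k : ℝ)⁻¹) (-(k : ℝ)⁻¹) := by
  refine closure_minimal (fun s hs => ?_) isClosed_Icc
  have hk' : (0 : ℝ) < k := by exact_mod_cast hk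
  have hs' : vcut b k s ≠ 0 := hs
  have h1 : 0 < (k : ℝ) * (s + b) - 1 := by
    by_contra hh
    exact left_ne_zero_of_mul hs' (Real.smoothTransition.zero_of_nonpos (not_lt.1 hh))
  have h2 : 0 < -(k : ℝ) * s - 1 := by
    by_contra hh
    exact right_ne_zero_of_mul hs' (Real.smoothTransition.zero_of_nonpos (not_lt.1 hh))
  have e : (k : ℝ) * (k : ℝ)⁻¹ = 1 := mul_inv_cancel₀ hk'.ne'
  constructor
  · refine le_of_mul_le_mul_left ?_ hk'
    nlinarith
  · refine le_of_mul_le_mul_left ?_ hk'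
    nlinarith

lemma tsupport_vcut_subset_Ioo (b : ℝ) {k : ℕ} (hk : 0 < k) :
    tsupport (vcut b k) ⊆ Ioo (-b) 0 := by
  have hk' : (0 : ℝ) < (k : ℝ)⁻¹ := by positivity
  exact (tsupport_vcut b hk).trans fun s hs => ⟨by linarith [hs.1], by linarith [hs.2]⟩

lemma hasCompactSupport_vcut (b : ℝ) {k : ℕ} (hk : 0 < k) : HasCompactSupport (vcut b k) :=
  isCompact_Icc.of_isClosed_subset (isClosed_tsupport _) (tsupport_vcut b hk)

lemma tendsto_vcut (b : ℝ) {s : ℝ} (hs : s ∈ Ioo (-b) 0) :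
    Tendsto (fun k => vcut b k s) atTop (𝓝 1) := by
  have h1 : Tendsto (fun k : ℕ => (k : ℝ) * (s + b)) atTop atTop :=
    tendsto_natCast_atTop_atTop.atTop_mul_const (by linarith [hs.1])
  have h2 : Tendsto (fun k : ℕ => (k : ℝ) * (-s)) atTop atTop :=
    tendsto_natCast_atTop_atTop.atTop_mul_const (by linarith [hs.2])
  refine tendsto_const_nhds.congr' ?_
  filter_upwards [h1.eventually_ge_atTop 2, h2.eventually_ge_atTop 2] with k h3 h4
  rw [vcut, Real.smoothTransition.one_of_one_le (by linarith),
    Real.smoothTransition.one_of_one_le (by linarith), one_mul]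

lemma contDiff_vcut_mul (b : ℝ) (k : ℕ) {η : ℝ → ℝ} (hη : ContDiff ℝ ∞ η) :
    ContDiff ℝ ∞ (fun s => vcut b k s * η s) := (contDiff_vcut b k).mul hη

lemma continuous_vcut_mul (b : ℝ) (k : ℕ) {η : ℝ → ℝ} (hη : Continuous η) :
    Continuous (fun s => vcut b k s * η s) := (contDiff_vcut b k).continuous.mul hη

/-- Dominated convergence: the cut-offs lie in `[0, 1]` and tend to `1` at every interior height.
This lets identities proved for compactly supported vertical factors pass to general ones. -/
lemma tendsto_inner_tens_vcut (b : ℝ) {η : ℝ → ℝ} (hη : Continuous η) (P : Surf)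
    (u : L2 (slab b)) :
    Tendsto (fun k => inner ℝ (tens b (continuous_vcut_mul b k hη) P) u) atTop
      (𝓝 (inner ℝ (tens b hη P) u)) := by
  have e : ∀ (η : ℝ → ℝ) (hη : Continuous η), inner ℝ (tens b hη P) u
      = ∫ x in slab b, u x * (η (x 0) * P (hpart x)) := by
    intro η hη
    rw [inner_eq_integral]
    refine integral_congr_ae ?_
    filter_upwards [tens_ae b hη P] with x hx
    rw [hx]
  have hP : MemLp P 2 volume := memLp_of_memLp_univ (Lp.memLp P)
  have hint : Integrable (fun x => u x * (η (x 0) * P (hpart x))) (volume.restrict (slab b)) :=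
    (Lp.memLp u).integrable_mul (memLp_tens b hη hP)
  simp only [e]
  refine tendsto_integral_of_dominated_convergence _ (fun k => ?_) hint.norm (fun k => ?_) ?_
  · exact ((Lp.memLp u).integrable_mul
      (memLp_tens b (continuous_vcut_mul b k hη) hP)).aestronglyMeasurable
  · refine ae_of_all _ fun x => ?_
    rw [show u x * (vcut b k (x 0) * η (x 0) * P (hpart x))
      = vcut b k (x 0) * (u x * (η (x 0) * P (hpart x))) by ring, norm_mul]
    refine mul_le_of_le_one_left (norm_nonneg _) ?_
    rw [Real.norm_of_nonneg (vcut_nonneg _ _ _)]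
    exact vcut_le_one _ _ _
  · filter_upwards [ae_restrict_mem (measurableSet_slab b)] with x hx
    have h1 := (tendsto_vcut b (s := x 0) hx).mul_const (u x * (η (x 0) * P (hpart x)))
    rw [one_mul] at h1
    refine h1.congr fun k => ?_
    ring

/-- Horizontal integration by parts without boundary conditions on the vertical factor. -/
theorem IsWeakDeriv.inner_tens_pd {b : ℝ} {j : Fin 2} {u w : L2 (slab b)}
    (h : IsWeakDeriv (slab b) j.succ u w) {η : ℝ → ℝ} (hη : ContDiff ℝ ∞ η)
    {ψ : Eu 2 → ℝ} (hψ : IsTest univ ψ) :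
    inner ℝ (tens b hη.continuous (toSurf ((hψ.pd j).memLp 2 volume))) u =
      - inner ℝ (tens b hη.continuous (toSurf (hψ.memLp 2 volume))) w := by
  refine tendsto_nhds_unique (tendsto_inner_tens_vcut b hη.continuous _ u)
    ((tendsto_inner_tens_vcut b hη.continuous _ w).neg.congr' ?_)
  filter_upwards [eventually_gt_atTop 0] with k hk
  -- A horizontal derivative does not touch the vertical cut-off, so its removal leaves no boundary
  -- term.
  exact (h.inner_tens_succ (contDiff_vcut_mul b k hη) ((hasCompactSupport_vcut b hk).mul_right)
    ((tsupport_mul_subset_left).trans (tsupport_vcut_subset_Ioo b hk)) hψ).symm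

/-- The vertical derivative commutes with `Λ̇_h^σ`, in the dual formulation. -/
theorem inner_tens_deriv_eq {b : ℝ} (hb : 0 ≤ b) {u w g h : L2 (slab b)} {R P : Surf}
    (hRP : ∀ (η : ℝ → ℝ) (hη : Continuous η), inner ℝ (tens b hη R) u = inner ℝ (tens b hη P) g)
    (hu : IsWeakDeriv (slab b) 0 u w) (hg : IsWeakDeriv (slab b) 0 g h)
    {η : ℝ → ℝ} (hη : ContDiff ℝ ∞ η) :
    inner ℝ (tens b hη.continuous R) w = inner ℝ (tens b hη.continuous P) h := by
  refine tendsto_nhds_unique (tendsto_inner_tens_vcut b hη.continuous R w)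
    ((tendsto_inner_tens_vcut b hη.continuous P h).congr' ?_)
  filter_upwards [eventually_gt_atTop 0] with k hk
  have hs := contDiff_vcut_mul b k hη
  have hc : HasCompactSupport (fun s => vcut b k s * η s) :=
    (hasCompactSupport_vcut b hk).mul_right
  have ht : tsupport (fun s => vcut b k s * η s) ⊆ Ioo (-b) 0 :=
    (tsupport_mul_subset_left).trans (tsupport_vcut_subset_Ioo b hk)
  have h1 := hu.inner_tens_zero_surf hb hs hc ht R
  have h2 := hg.inner_tens_zero_surf hb hs hc ht P
  -- The duality is applied with the derivative of the whole product `vcut * η` as vertical factor.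
  -- The large derivative of the cut-off therefore never has to be estimated.
  have h3 := hRP _ (hs.continuous_deriv (by simp))
  linarith

/-! ### Traces tested against functions on the plane -/

/-- A vertical cut-off which is `1` at the top and vanishes near the bottom. -/
def chiTop (b s : ℝ) : ℝ :=
  Real.smoothTransition (3 * (s + b) / b - 1) * Real.smoothTransition (2 - s)

/-- The complement of `chiTop` on the slab, which vanishes near the top. -/
def chiBot (b s : ℝ) : ℝ :=
  (1 - Real.smoothTransition (3 * (s + b) / b - 1)) * Real.smoothTransition (s + b + 2)

lemma contDiff_chiTop (b : ℝ) : ContDiff ℝ ∞ (chiTop b) := by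
  unfold chiTop
  exact (Real.smoothTransition.contDiff.comp (by fun_prop)).mul
    (Real.smoothTransition.contDiff.comp (by fun_prop))

lemma contDiff_chiBot (b : ℝ) : ContDiff ℝ ∞ (chiBot b) := by
  unfold chiBot
  exact (contDiff_const.sub (Real.smoothTransition.contDiff.comp (by fun_prop))).mul
    (Real.smoothTransition.contDiff.comp (by fun_prop))

/-- The factor `smoothTransition (2 - s)` equals `1` for `s ≤ 1`; it only makes the support compact
above the slab. -/
lemma tsupport_chiTop {b : ℝ} (hb : 0 < b) : tsupport (chiTop b) ⊆ Icc (-b + b / 3) 2 := by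
  refine closure_minimal (fun s hs => ?_) isClosed_Icc
  have hs' : chiTop b s ≠ 0 := hs
  have h1 : 0 < 3 * (s + b) / b - 1 := by
    by_contra hh
    exact left_ne_zero_of_mul hs' (Real.smoothTransition.zero_of_nonpos (not_lt.1 hh))
  have h2 : 0 < 2 - s := by
    by_contra hh
    exact right_ne_zero_of_mul hs' (Real.smoothTransition.zero_of_nonpos (not_lt.1 hh))
  rw [sub_pos, lt_div_iff₀ hb] at h1
  constructor <;> linarith

lemma tsupport_chiBot {b : ℝ} (hb : 0 < b) : tsupport (chiBot b) ⊆ Icc (-b - 2) (-(b / 3)) := by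
  refine closure_minimal (fun s hs => ?_) isClosed_Icc
  have hs' : chiBot b s ≠ 0 := hs
  have h1 : 3 * (s + b) / b - 1 < 1 := by
    by_contra hh
    refine left_ne_zero_of_mul hs' ?_
    rw [Real.smoothTransition.one_of_one_le (not_lt.1 hh), sub_self]
  have h2 : 0 < s + b + 2 := by
    by_contra hh
    exact right_ne_zero_of_mul hs' (Real.smoothTransition.zero_of_nonpos (not_lt.1 hh))
  rw [sub_lt_iff_lt_add, div_lt_iff₀ hb] at h1
  constructor <;> linarith

lemma chiTop_zero {b : ℝ} (hb : 0 < b) : chiTop b 0 = 1 := by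
  rw [chiTop, Real.smoothTransition.one_of_one_le, Real.smoothTransition.one_of_one_le, one_mul]
  · norm_num
  · field_simp; linarith

lemma chiTop_add_chiBot {b s : ℝ} (h : s ∈ Ioo (-b) 0) : chiTop b s + chiBot b s = 1 := by
  rw [chiTop, chiBot, Real.smoothTransition.one_of_one_le (x := 2 - s) (by linarith [h.2]),
    Real.smoothTransition.one_of_one_le (x := s + b + 2) (by linarith [h.1])]
  ring

lemma deriv_chiTop_add_deriv_chiBot {b s : ℝ} (h : s ∈ Ioo (-b) 0) :
    deriv (chiTop b) s + deriv (chiBot b) s = 0 := by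
  have h1 : (chiTop b + chiBot b) =ᶠ[𝓝 s] fun _ => 1 := by
    filter_upwards [isOpen_Ioo.mem_nhds h] with r hr using chiTop_add_chiBot hr
  have h2 := h1.deriv_eq
  rw [deriv_const, deriv_add ((contDiff_chiTop b).differentiable (by simp) s)
    ((contDiff_chiBot b).differentiable (by simp) s)] at h2
  exact h2

lemma continuous_deriv_chiTop (b : ℝ) : Continuous (deriv (chiTop b)) :=
  (contDiff_chiTop b).continuous_deriv (by simp)

/-- The trace of `u` on `Σ₀`, tested against `ψ`, by Green's formula. -/
def topPairing (b : ℝ) {ψ : Eu 2 → ℝ} (hψ : IsTest univ ψ) (u : L2 (slab b)) : ℝ :=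
  inner ℝ (tens b (continuous_deriv_chiTop b) (toSurf (hψ.memLp 2 volume))) u +
    inner ℝ (tens b (contDiff_chiTop b).continuous (toSurf (hψ.memLp 2 volume))) (wd 0 u)

lemma inner_toSurf {ψ : Eu 2 → ℝ} (hψ : MemLp ψ 2 volume) (g : Surf) :
    inner ℝ (toSurf hψ) g = ∫ y, g y * ψ y := by
  rw [toSurf, inner_toLp]
  simp

lemma integral_green {b : ℝ} {η : ℝ → ℝ} (hη : ContDiff ℝ ∞ η) {ψ : Eu 2 → ℝ}
    (hψ : IsTest univ ψ) (u w : L2 (slab b)) :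
    ∫ x in slab b, (u x * pd 0 (fun x : Eu 3 => η (x 0) * ψ (hpart x)) x
        + w x * (η (x 0) * ψ (hpart x))) =
      inner ℝ (tens b (hη.continuous_deriv (by simp)) (toSurf (hψ.memLp 2 volume))) u +
        inner ℝ (tens b hη.continuous (toSurf (hψ.memLp 2 volume))) w := by
  rw [inner_tens, inner_tens, ← integral_add, pd_zero_prod hη hψ.1]
  · exact (Lp.memLp u).integrable_mul (memLp_tens b (hη.continuous_deriv (by simp))
      (hψ.memLp 2 volume))
  · exact (Lp.memLp w).integrable_mul (memLp_tens b hη.continuous (hψ.memLp 2 volume))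

/-- The pairing is defined from `u` and `wd 0 u` alone. It can thus be integrated in time without
choosing traces, and this lemma recovers the actual trace whenever there is one. -/
lemma IsTraceTop.topPairing_eq {b : ℝ} (hb : 0 < b) {u : L2 (slab b)} {g : Surf}
    (h : IsTraceTop b u g) {ψ : Eu 2 → ℝ} (hψ : IsTest univ ψ) :
    topPairing b hψ u = inner ℝ (toSurf (hψ.memLp 2 volume)) g := by
  obtain ⟨w, hw, hg⟩ := h
  have ht := isTest_prod (I := Ioi (-b)) (contDiff_chiTop b)
    (isCompact_Icc.of_isClosed_subset (isClosed_tsupport _) (tsupport_chiTop hb))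
    ((tsupport_chiTop hb).trans fun s hs => by
      have := hs.1; simp only [mem_Ioi]; linarith) hψ
  have := hg _ ht
  rw [integral_green (contDiff_chiTop b) hψ] at this
  rw [topPairing, hw.wd_eq (isOpen_slab b), this, inner_toSurf]
  simp [chiTop_zero hb]

/-- A weak form of `u(0, y) = ∫ ∂₁u(s, y) ds` for `u` vanishing at the bottom. Green's formula with
`chiBot` contributes zero and is added to the one with `chiTop`; on the slab the cut-offs sum to `1`
and their derivatives cancel. -/
lemma topPairing_eq_of_isTraceBot {b : ℝ} (hb : 0 < b) {u : L2 (slab b)}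
    (h : IsTraceBot b u 0) {ψ : Eu 2 → ℝ} (hψ : IsTest univ ψ) :
    topPairing b hψ u =
      inner ℝ (tens b (continuous_const (X := ℝ) (y := (1 : ℝ)))
        (toSurf (hψ.memLp 2 volume))) (wd 0 u) := by
  obtain ⟨w, hw, hg⟩ := h
  have ht := isTest_prod (I := Iio 0) (contDiff_chiBot b)
    (isCompact_Icc.of_isClosed_subset (isClosed_tsupport _) (tsupport_chiBot hb))
    ((tsupport_chiBot hb).trans fun s hs => by
      have := hs.2; simp only [mem_Iio]; linarith) hψ
  have h0 := hg _ ht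
  rw [integral_green (contDiff_chiBot b) hψ] at h0
  have hz : ∫ y, (0 : Surf) y * (chiBot b (pt (-b) y 0) * ψ (hpart (pt (-b) y))) = 0 := by
    refine integral_eq_zero_of_ae ?_
    filter_upwards [ae_of_ae_restrict_univ (Lp.coeFn_zero ℝ 2 (volume.restrict univ))] with y hy
    rw [hy]; simp
  rw [hz, neg_zero] at h0
  rw [topPairing, hw.wd_eq (isOpen_slab b)]
  have hP := hψ.memLp 2 volume
  have e : ∀ (α β γ : ℝ → ℝ) (hα : Continuous α) (hβ : Continuous β) (hγ : Continuous γ)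
      (v : L2 (slab b)), (∀ s ∈ Ioo (-b) 0, α s + β s = γ s) →
      inner ℝ (tens b hα (toSurf hP)) v + inner ℝ (tens b hβ (toSurf hP)) v =
        inner ℝ (tens b hγ (toSurf hP)) v := by
    intro α β γ hα hβ hγ v hs
    rw [inner_tens, inner_tens, inner_tens, ← integral_add]
    · refine integral_congr_ae ?_
      filter_upwards [ae_restrict_mem (measurableSet_slab b)] with x hx
      rw [← hs _ hx]; ring
    · exact (Lp.memLp v).integrable_mul (memLp_tens b hα hP)
    · exact (Lp.memLp v).integrable_mul (memLp_tens b hβ hP)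
  have e1 := e _ _ (fun _ => 0) (continuous_deriv_chiTop b)
    ((contDiff_chiBot b).continuous_deriv (by simp)) continuous_const u
    fun s hs => deriv_chiTop_add_deriv_chiBot hs
  have e2 := e _ _ (fun _ => 1) (contDiff_chiTop b).continuous
    (contDiff_chiBot b).continuous continuous_const w fun s hs => chiTop_add_chiBot hs
  have e3 : inner ℝ (tens b (continuous_const (y := (0 : ℝ))) (toSurf hP)) u = 0 := by
    rw [inner_tens]; simp
  rw [e3] at e1
  linarith

/-! ### Bounds by the norm of `Λ̇_h^σ v` -/

/-- Used for `onLambda` and `onTop`, which are infima over candidates: a bound valid for each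
candidate of finite norm passes to the infimum after squaring. The condition `C ≠ 0` matters when no
candidate exists, since the right side must then be `∞` and not `0 * ∞ = 0`. -/
lemma le_mul_biInf_rpow_half {α : Type*} {p : α → Prop} {N : α → ℝ≥0∞} {a : ℝ≥0∞} {C : ℝ≥0}
    (hC : C ≠ 0) (h : ∀ g, p g → N g < ⊤ → a ≤ C * N g ^ (1 / 2 : ℝ)) :
    a ≤ C * (⨅ (g : α) (_ : p g), N g) ^ (1 / 2 : ℝ) := by
  have hC' : (C : ℝ≥0∞) ≠ 0 := by exact_mod_cast hC
  set X := ⨅ (g : α) (_ : p g), N g with hX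
  have key : (a / C) ^ (2 : ℝ) ≤ X := by
    refine le_iInf₂ fun g hg => ?_
    rcases eq_or_ne (N g) ⊤ with ht | ht
    · rw [ht]; exact le_top
    have h1 : a / C ≤ N g ^ (1 / 2 : ℝ) := ENNReal.div_le_of_le_mul' (h g hg (lt_top_iff_ne_top.2 ht))
    calc (a / C) ^ (2 : ℝ) ≤ (N g ^ (1 / 2 : ℝ)) ^ (2 : ℝ) := by gcongr
      _ = N g := by rw [← ENNReal.rpow_mul]; norm_num
  have h2 : a / C ≤ X ^ (1 / 2 : ℝ) := by
    calc a / C = ((a / C) ^ (2 : ℝ)) ^ (1 / 2 : ℝ) := by rw [← ENNReal.rpow_mul]; norm_num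
      _ ≤ _ := by gcongr
  rwa [ENNReal.div_le_iff_le_mul (Or.inl hC') (Or.inl ENNReal.coe_ne_top), mul_comm] at h2

lemma le_rpow_half_of_sq_le {x y : ℝ≥0∞} (h : x ^ 2 ≤ y) : x ≤ y ^ (1 / 2 : ℝ) := by
  calc x = (x ^ 2) ^ (1 / 2 : ℝ) := by
        rw [← ENNReal.rpow_natCast, ← ENNReal.rpow_mul]; norm_num
    _ ≤ _ := by gcongr

lemma enorm_le_tanSqV (b : ℝ) (s N : ℕ) (f : VF b) (j : Fin 3) :
    ‖f j‖ₑ ≤ tanSqV b s N f ^ (1 / 2 : ℝ) :=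
  le_rpow_half_of_sq_le ((enorm_sq_le_sobSq _ s _).trans (sobSq_le_tanSqV b s N f j))

lemma enorm_wd_le_tanSqV (b : ℝ) {s : ℕ} (hs : 1 ≤ s) (N : ℕ) (f : VF b) (i j : Fin 3) :
    ‖wd i (f j)‖ₑ ≤ tanSqV b s N f ^ (1 / 2 : ℝ) :=
  le_rpow_half_of_sq_le ((enorm_wd_sq_le_sobSq (isOpen_slab b) hs i _).trans
    (sobSq_le_tanSqV b s N f j))

lemma isWeakDeriv_wd_of_tanSqV {b : ℝ} {s N : ℕ} (hs : 1 ≤ s) {f : VF b}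
    (h : tanSqV b s N f < ⊤) (i j : Fin 3) : IsWeakDeriv (slab b) i (f j) (wd i (f j)) :=
  isWeakDeriv_wd_of_sobSq_lt_top (isOpen_slab b) hs i ((sobSq_le_tanSqV b s N f j).trans_lt h)

lemma enorm_inner_le {n : ℕ} {U : Set (Eu n)} (f u : L2 U) :
    ‖(inner ℝ f u : ℝ)‖ₑ ≤ ‖f‖ₑ * ‖u‖ₑ := by
  rw [← ofReal_norm, ← ofReal_norm, ← ofReal_norm, ← ENNReal.ofReal_mul (norm_nonneg _)]
  exact ENNReal.ofReal_le_ofReal (norm_inner_le_norm f u)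

/-- The trace of `v¹` on the top is controlled by `Λ̇_h^σ v`. -/
theorem exists_enorm_topPairing_le {b σ : ℝ} (hb : 0 < b) (hσ : 0 < σ) (hσ1 : σ < 1)
    {ψ : Eu 2 → ℝ} (hψ : IsTest univ ψ) :
    ∃ C : ℝ≥0, ∀ v : VF b, IsWeakDeriv (slab b) 0 (v 0) (wd 0 (v 0)) →
      ‖topPairing b hψ (v 0)‖ₑ ≤ C * onLambda b σ (tanSqV b 2 2) v ^ (1 / 2 : ℝ) := by
  obtain ⟨P, -, hP⟩ := exists_lambda_dual hσ hσ1 hψ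
  -- The summand `1` only keeps the constant nonzero.
  refine ⟨‖tens b (continuous_deriv_chiTop b) P‖₊ + ‖tens b (contDiff_chiTop b).continuous P‖₊ + 1,
    fun v hv => le_mul_biInf_rpow_half (by positivity) fun g hg hN => ?_⟩
  have hgw := isWeakDeriv_wd_of_tanSqV (by norm_num) hN 0 0
  rw [topPairing, hP b _ _ (hg 0),
    inner_tens_deriv_eq hb.le (hP b _ _ (hg 0)) hv hgw (contDiff_chiTop b)]
  calc _ ≤ ‖tens b (continuous_deriv_chiTop b) P‖ₑ * tanSqV b 2 2 g ^ (1 / 2 : ℝ)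
        + ‖tens b (contDiff_chiTop b).continuous P‖ₑ * tanSqV b 2 2 g ^ (1 / 2 : ℝ) := by
        refine (enorm_add_le _ _).trans (add_le_add ((enorm_inner_le _ _).trans ?_)
          ((enorm_inner_le _ _).trans ?_))
        · gcongr; exact enorm_le_tanSqV b 2 2 g 0
        · gcongr; exact enorm_wd_le_tanSqV b (by norm_num) 2 g 0 0
    _ ≤ _ := by
        rw [← add_mul]
        gcongr
        push_cast
        exact le_self_add

/-- For divergence free fields vanishing at the bottom, the trace of `v¹` at the top is the
horizontal divergence of the flux, which gains one derivative. -/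
theorem enorm_topPairing_le_of_divFree {b σ : ℝ} (hb : 0 < b) (hσ : 0 < σ) (hσ1 : σ < 1)
    {ψ : Eu 2 → ℝ} (hψ : IsTest univ ψ) {C : ℝ≥0} (hC : C ≠ 0)
    (hCψ : √b * (lamNorm σ (pd 0 ψ) + lamNorm σ (pd 1 ψ)) ≤ C) {v : VF b}
    (hv : ∀ i j, IsWeakDeriv (slab b) i (v j) (wd i (v j)))
    (hbot : IsTraceBot b (v 0) 0) (hdiv : ∑ i, wd i (v i) = 0) :
    ‖topPairing b hψ (v 0)‖ₑ ≤ C * onLambda b σ (tanSqV b 2 2) v ^ (1 / 2 : ℝ) := by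
  obtain ⟨P₀, hn₀, hP₀⟩ := exists_lambda_dual hσ hσ1 (hψ.pd 0)
  obtain ⟨P₁, hn₁, hP₁⟩ := exists_lambda_dual hσ hσ1 (hψ.pd 1)
  refine le_mul_biInf_rpow_half hC fun g hg hN => ?_
  set c1 := (contDiff_const (c := (1 : ℝ)) (n := ∞) (𝕜 := ℝ) (E := ℝ)) with hc1
  -- By the divergence condition `∂₁v¹` is replaced by `-∂₂v² - ∂₃v³`, and horizontal integration by
  -- parts moves these derivatives onto `ψ`. The vertical factor is the constant `1`, whose `L²`
  -- norm on `(-b, 0)` is the `√b` of the bound.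
  have e : topPairing b hψ (v 0) =
      inner ℝ (tens b c1.continuous P₀) (g 1) + inner ℝ (tens b c1.continuous P₁) (g 2) := by
    rw [topPairing_eq_of_isTraceBot hb hbot hψ]
    rw [Fin.sum_univ_three] at hdiv
    have h0 : wd 0 (v 0) = -(wd 1 (v 1)) + -(wd 2 (v 2)) := by
      rw [← sub_eq_zero, ← hdiv]; abel
    have h1 := IsWeakDeriv.inner_tens_pd (j := 0) (hv 1 1) c1 hψ
    have h2 := IsWeakDeriv.inner_tens_pd (j := 1) (hv 2 2) c1 hψ
    rw [h0, inner_add_right, inner_neg_right, inner_neg_right, ← h1, ← h2,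
      hP₀ b _ _ (hg 1), hP₁ b _ _ (hg 2)]
  have hnorm : ∀ P : Surf, ‖tens b c1.continuous P‖ₑ ≤ ENNReal.ofReal (√b * ‖P‖) := by
    intro P
    rw [← ofReal_norm]
    refine ENNReal.ofReal_le_ofReal ?_
    have := norm_tens_le hb.le c1.continuous zero_le_one (fun s _ => by simp) P
    rwa [one_mul] at this
  rw [e]
  calc _ ≤ ENNReal.ofReal (√b * ‖P₀‖) * tanSqV b 2 2 g ^ (1 / 2 : ℝ)
        + ENNReal.ofReal (√b * ‖P₁‖) * tanSqV b 2 2 g ^ (1 / 2 : ℝ) := by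
        refine (enorm_add_le _ _).trans (add_le_add ((enorm_inner_le _ _).trans ?_)
          ((enorm_inner_le _ _).trans ?_))
        · exact mul_le_mul' (hnorm _) (enorm_le_tanSqV b 2 2 g 1)
        · exact mul_le_mul' (hnorm _) (enorm_le_tanSqV b 2 2 g 2)
    _ ≤ _ := by
        rw [← add_mul, ← ENNReal.ofReal_add (by positivity) (by positivity), ← mul_add]
        gcongr
        rw [← ENNReal.ofReal_coe_nnreal]
        refine ENNReal.ofReal_le_ofReal (le_trans ?_ hCψ)
        gcongr

/-! ### The displacement as the time integral of the velocity -/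

lemma tendsto_of_enorm_sub_le {E ι : Type*} [NormedAddCommGroup E] {l : Filter ι} {f : ι → E} {a : E}
    {N : ι → ℝ≥0∞} (hN : Tendsto N l (𝓝 0)) (h : ∀ᶠ t in l, ‖f t - a‖ₑ ≤ N t ^ (1 / 2 : ℝ)) :
    Tendsto f l (𝓝 a) := by
  rw [tendsto_iff_edist_tendsto_0]
  have h0 : Tendsto (fun t => N t ^ (1 / 2 : ℝ)) l (𝓝 0) := by
    have := (ENNReal.continuous_rpow_const (y := (1 / 2 : ℝ))).tendsto 0
    rw [ENNReal.zero_rpow_of_pos (by norm_num)] at this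
    exact this.comp hN
  refine tendsto_of_tendsto_of_tendsto_of_le_of_le' tendsto_const_nhds h0
    (Eventually.of_forall fun _ => zero_le) ?_
  filter_upwards [h] with t ht
  rwa [edist_eq_enorm_sub]

lemma ContIn.continuousOn {b : ℝ} {s N : ℕ} {v : ℝ → VF b} (h : ContIn (tanSqV b s N) v)
    (j : Fin 3) : ContinuousOn (fun t => v t j) (Ici 0) := by
  intro t₀ ht₀
  exact tendsto_of_enorm_sub_le (h.2 t₀ ht₀) (Eventually.of_forall fun t =>
    enorm_le_tanSqV b s N (v t - v t₀) j)

lemma ContIn.isWeakDeriv {b : ℝ} {s N : ℕ} (hs : 1 ≤ s) {v : ℝ → VF b}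
    (h : ContIn (tanSqV b s N) v) {t : ℝ} (ht : 0 ≤ t) (i j : Fin 3) :
    IsWeakDeriv (slab b) i (v t j) (wd i (v t j)) :=
  isWeakDeriv_wd_of_tanSqV hs (h.1 t ht) i j

lemma ContIn.continuousOn_wd {b : ℝ} {s N : ℕ} (hs : 1 ≤ s) {v : ℝ → VF b}
    (h : ContIn (tanSqV b s N) v) (i j : Fin 3) :
    ContinuousOn (fun t => wd i (v t j)) (Ici 0) := by
  intro t₀ ht₀
  refine tendsto_of_enorm_sub_le (h.2 t₀ ht₀) ?_
  filter_upwards [self_mem_nhdsWithin] with t ht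
  have e : wd i ((v t - v t₀) j) = wd i (v t j) - wd i (v t₀ j) :=
    ((h.isWeakDeriv hs ht i j).sub (h.isWeakDeriv hs ht₀ i j)).wd_eq (isOpen_slab b)
  rw [← e]
  exact enorm_wd_le_tanSqV b hs N (v t - v t₀) i j

lemma intervalIntegrable_of_continuousOn_Ici {E : Type*} [NormedAddCommGroup E]
    {f : ℝ → E} (h : ContinuousOn f (Ici 0)) {t : ℝ} (ht : 0 ≤ t) :
    IntervalIntegrable f volume 0 t :=
  (h.mono (by rw [uIcc_of_le ht]; exact Icc_subset_Ici_self)).intervalIntegrable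

lemma inner_intervalIntegral {n : ℕ} {U : Set (Eu n)} {f : ℝ → L2 U}
    (h : ContinuousOn f (Ici 0)) {t : ℝ} (ht : 0 ≤ t) (φ : L2 U) :
    inner ℝ φ (∫ τ in (0 : ℝ)..t, f τ) = ∫ τ in (0 : ℝ)..t, (inner ℝ φ (f τ) : ℝ) :=
  ((innerSL ℝ φ).intervalIntegral_comp_comm (intervalIntegrable_of_continuousOn_Ici h ht)).symm

lemma flow_eq_integral {b : ℝ} {N : ℕ} {v ξ : ℝ → VF b} (hc : ContIn (tanSqV b 1 N) v)
    (hk : ∀ t, 0 ≤ t → ∀ i, HasDerivWithinAt (fun s => ξ s i) (v t i) (Ici 0) t)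
    {t : ℝ} (ht : 0 ≤ t) (i : Fin 3) :
    ξ t i = ξ 0 i + ∫ τ in (0 : ℝ)..t, v τ i := by
  rw [intervalIntegral.integral_eq_sub_of_hasDeriv_right (f := fun s => ξ s i)]
  · abel
  · rw [uIcc_of_le ht]
    exact fun s hs => ((hk s hs.1 i).continuousWithinAt).mono Icc_subset_Ici_self
  · intro s hs
    rw [min_eq_left ht] at hs
    exact (hk s hs.1.le i).mono fun r hr => le_trans hs.1.le (le_of_lt hr)
  · exact intervalIntegrable_of_continuousOn_Ici (hc.continuousOn i) ht

/-- Pairing with a fixed test function commutes with the time integral, hence so does weak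
differentiation. -/
lemma isWeakDeriv_flow {b : ℝ} {N : ℕ} {v ξ : ℝ → VF b} (hc : ContIn (tanSqV b 1 N) v)
    (hk : ∀ t, 0 ≤ t → ∀ i, HasDerivWithinAt (fun s => ξ s i) (v t i) (Ici 0) t)
    (h0 : ∀ i j, IsWeakDeriv (slab b) i (ξ 0 j) (wd i (ξ 0 j)))
    {t : ℝ} (ht : 0 ≤ t) (i j : Fin 3) :
    IsWeakDeriv (slab b) i (ξ t j)
      (wd i (ξ 0 j) + ∫ τ in (0 : ℝ)..t, wd i (v τ j) : L2 (slab b)) := by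
  rw [flow_eq_integral hc hk ht j]
  refine (h0 i j).add ?_
  rw [isWeakDeriv_iff]
  intro φ hφ
  rw [inner_intervalIntegral (hc.continuousOn j) ht,
    inner_intervalIntegral (hc.continuousOn_wd le_rfl i j) ht, ← intervalIntegral.integral_neg]
  refine intervalIntegral.integral_congr fun τ hτ => ?_
  rw [uIcc_of_le ht] at hτ
  exact isWeakDeriv_iff.1 (hc.isWeakDeriv le_rfl hτ.1 i j) φ hφ

lemma wd_flow {b : ℝ} {N : ℕ} {v ξ : ℝ → VF b} (hc : ContIn (tanSqV b 1 N) v)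
    (hk : ∀ t, 0 ≤ t → ∀ i, HasDerivWithinAt (fun s => ξ s i) (v t i) (Ici 0) t)
    (h0 : ∀ i j, IsWeakDeriv (slab b) i (ξ 0 j) (wd i (ξ 0 j)))
    {t : ℝ} (ht : 0 ≤ t) (i j : Fin 3) :
    wd i (ξ t j) = wd i (ξ 0 j) + ∫ τ in (0 : ℝ)..t, wd i (v τ j) :=
  (isWeakDeriv_flow hc hk h0 ht i j).wd_eq (isOpen_slab b)

lemma continuousOn_topPairing {b : ℝ} {N : ℕ} {v : ℝ → VF b}
    (hc : ContIn (tanSqV b 1 N) v) {ψ : Eu 2 → ℝ} (hψ : IsTest univ ψ) :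
    ContinuousOn (fun t => topPairing b hψ (v t 0)) (Ici 0) :=
  (continuousOn_const.inner (hc.continuousOn 0)).add
    (continuousOn_const.inner (hc.continuousOn_wd le_rfl 0 0))

lemma topPairing_flow {b : ℝ} {N : ℕ} {v ξ : ℝ → VF b} (hc : ContIn (tanSqV b 1 N) v)
    (hk : ∀ t, 0 ≤ t → ∀ i, HasDerivWithinAt (fun s => ξ s i) (v t i) (Ici 0) t)
    (h0 : ∀ i j, IsWeakDeriv (slab b) i (ξ 0 j) (wd i (ξ 0 j)))
    {ψ : Eu 2 → ℝ} (hψ : IsTest univ ψ) {t : ℝ} (ht : 0 ≤ t) :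
    topPairing b hψ (ξ t 0) =
      topPairing b hψ (ξ 0 0) + ∫ τ in (0 : ℝ)..t, topPairing b hψ (v τ 0) := by
  have c1 := hc.continuousOn 0
  have c2 := hc.continuousOn_wd le_rfl 0 0
  simp only [topPairing]
  rw [intervalIntegral.integral_add
    (intervalIntegrable_of_continuousOn_Ici (continuousOn_const.inner c1) ht)
    (intervalIntegrable_of_continuousOn_Ici (continuousOn_const.inner c2) ht),
    ← inner_intervalIntegral c1 ht, ← inner_intervalIntegral c2 ht, wd_flow hc hk h0 ht,
    flow_eq_integral hc hk ht]
  simp only [inner_add_right]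
  ring

/-- Used at a fixed time while `ε → 0`, where `A` is of order `ε`; the growth in `t` is harmless. -/
lemma norm_wd_flow_le {b : ℝ} {N : ℕ} {v ξ : ℝ → VF b} (hc : ContIn (tanSqV b 1 N) v)
    (hk : ∀ t, 0 ≤ t → ∀ i, HasDerivWithinAt (fun s => ξ s i) (v t i) (Ici 0) t)
    (h0 : ∀ i j, IsWeakDeriv (slab b) i (ξ 0 j) (wd i (ξ 0 j)))
    {t : ℝ} (ht : 0 ≤ t) (i j : Fin 3) {A : ℝ}
    (hA : ∀ τ, 0 ≤ τ → ‖wd i (v τ j)‖ ≤ A) : ‖wd i (ξ t j)‖ ≤ ‖wd i (ξ 0 j)‖ + A * t := by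
  rw [wd_flow hc hk h0 ht]
  refine (norm_add_le _ _).trans (add_le_add le_rfl ?_)
  have := intervalIntegral.norm_integral_le_of_norm_le_const (a := 0) (b := t) (C := A)
    (f := fun τ => wd i (v τ j)) fun τ hτ => by
      rw [uIoc_of_le ht] at hτ
      exact hA τ hτ.1.le
  rwa [sub_zero, abs_of_nonneg ht] at this

/-! ### The linearized incompressibility condition -/

/-- The determinant and the inverse in the incompressibility condition are not controlled by `L²`
convergence of gradients. Almost everywhere convergence of all entries along one common subsequence
replaces it. -/
lemma exists_subseq_tendsto_ae {n : ℕ} {U : Set (Eu n)} {ι : Type*} (F : ι → ℕ → L2 U)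
    (F' : ι → L2 U) (h : ∀ i, Tendsto (F i) atTop (𝓝 (F' i))) (s : Finset ι) :
    ∃ ns : ℕ → ℕ, StrictMono ns ∧ ∀ i ∈ s, ∀ᵐ x ∂(volume.restrict U),
      Tendsto (fun k => F i (ns k) x) atTop (𝓝 (F' i x)) := by
  classical
  induction s using Finset.induction_on with
  | empty => exact ⟨id, strictMono_id, by simp⟩
  | insert a s _ ih =>
    obtain ⟨ns, hns, hs⟩ := ih
    have h1 : TendstoInMeasure (volume.restrict U) (fun k => ⇑(F a (ns k))) atTop (F' a) :=
      tendstoInMeasure_of_tendsto_Lp ((h a).comp hns.tendsto_atTop)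
    obtain ⟨ms, hms, hm⟩ := h1.exists_seq_tendsto_ae
    refine ⟨ns ∘ ms, hns.comp hms, fun i hi => ?_⟩
    rcases Finset.mem_insert.1 hi with rfl | hi
    · exact hm
    · filter_upwards [hs i hi] with x hx
      exact hx.comp hms.tendsto_atTop

/-- The inverse is the adjugate divided by the determinant, so `𝒜` tends to the identity as `Dξ →
0`. The formula also holds for singular matrices under the convention `0⁻¹ = 0`, so no invertibility
along the sequence is required. -/
lemma tendsto_divA {G V : ℕ → Matrix (Fin 3) (Fin 3) ℝ} {V' : Matrix (Fin 3) (Fin 3) ℝ}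
    (hG : Tendsto G atTop (𝓝 0)) (hV : Tendsto V atTop (𝓝 V')) :
    Tendsto (fun k => divA (G k) (V k)) atTop (𝓝 (∑ i, V' i i)) := by
  have h1 : Tendsto (fun k => 1 + G k) atTop (𝓝 1) := by simpa using tendsto_const_nhds.add hG
  have hdet : Tendsto (fun k => ((1 + G k).det)⁻¹) atTop (𝓝 1) := by
    have := ((Continuous.matrix_det (continuous_id)).tendsto
      (1 : Matrix (Fin 3) (Fin 3) ℝ)).comp h1
    simpa using this.inv₀ (by simp)
  have hadj : Tendsto (fun k => (1 + G k).adjugate) atTop (𝓝 1) := by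
    have := ((Continuous.matrix_adjugate (continuous_id)).tendsto
      (1 : Matrix (Fin 3) (Fin 3) ℝ)).comp h1
    rw [id, Matrix.adjugate_one] at this
    exact this
  have hinv : Tendsto (fun k => (1 + G k)⁻¹) atTop (𝓝 1) := by
    have := hdet.smul hadj
    simpa [Matrix.inv_def, Ring.inverse_eq_inv'] using this
  have hent : ∀ i j, Tendsto (fun k => calA (G k) i j) atTop
      (𝓝 ((1 : Matrix (Fin 3) (Fin 3) ℝ) j i)) := fun i j =>
    (tendsto_pi_nhds.1 (tendsto_pi_nhds.1 hinv j) i)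
  have hVe : ∀ i j, Tendsto (fun k => V k i j) atTop (𝓝 (V' i j)) := fun i j =>
    (tendsto_pi_nhds.1 (tendsto_pi_nhds.1 hV i) j)
  have := tendsto_finsetSum (Finset.univ : Finset (Fin 3)) fun i _ =>
    tendsto_finsetSum (Finset.univ : Finset (Fin 3)) fun j _ => (hent i j).mul (hVe i j)
  have e : ∑ i, ∑ j, (1 : Matrix (Fin 3) (Fin 3) ℝ) j i * V' i j = ∑ i, V' i i := by
    simp [Matrix.one_apply]
  rw [e] at this
  exact this

/-- If incompressible flows `ξₖ → 0` have velocities `vₖ = εₖ v + o(εₖ)`, then `∇·v = 0`. -/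
theorem sum_wd_eq_zero_of_incompressible {b : ℝ} {ε : ℕ → ℝ} {ξ v : ℕ → VF b}
    {v' : VF b} (hξ : ∀ i j, Tendsto (fun k => wd j (ξ k i)) atTop (𝓝 0))
    (hv : ∀ i j, Tendsto (fun k => (ε k)⁻¹ • wd j (v k i)) atTop (𝓝 (wd j (v' i))))
    (hinc : ∀ k, Incompressible b (ξ k) (v k)) : ∑ i, wd i (v' i) = 0 := by
  -- The Boolean index merges the entries of `Dξ` and of the rescaled `Dv` into one family, so that
  -- a single subsequence serves both.
  obtain ⟨ns, hns, hae⟩ := exists_subseq_tendsto_ae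
    (fun p : Bool × Fin 3 × Fin 3 => fun k =>
      if p.1 then wd p.2.2 (ξ k p.2.1) else (ε k)⁻¹ • wd p.2.2 (v k p.2.1))
    (fun p => if p.1 then 0 else wd p.2.2 (v' p.2.1))
    (by rintro ⟨c, i, j⟩; cases c
        · simpa using hv i j
        · simpa using hξ i j) Finset.univ
  have hG : ∀ᵐ x ∂(volume.restrict (slab b)), ∀ i j,
      Tendsto (fun k => wd j (ξ (ns k) i) x) atTop (𝓝 0) := by
    rw [ae_all_iff]; intro i
    rw [ae_all_iff]; intro j
    filter_upwards [hae (true, i, j) (Finset.mem_univ _), Lp.coeFn_zero ℝ 2 (volume.restrict (slab b))]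
      with x hx h0
    simp only [if_true] at hx
    rwa [h0] at hx
  have hsm : ∀ᵐ x ∂(volume.restrict (slab b)), ∀ k i j,
      ((ε k)⁻¹ • wd j (v k i) : L2 (slab b)) x = (ε k)⁻¹ * wd j (v k i) x := by
    rw [ae_all_iff]; intro k
    rw [ae_all_iff]; intro i
    rw [ae_all_iff]; intro j
    filter_upwards [Lp.coeFn_smul (ε k)⁻¹ (wd j (v k i))] with x hx
    rw [hx]; rfl
  have hV : ∀ᵐ x ∂(volume.restrict (slab b)), ∀ i j,
      Tendsto (fun k => (ε (ns k))⁻¹ * wd j (v (ns k) i) x) atTop (𝓝 (wd j (v' i) x)) := by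
    rw [ae_all_iff]; intro i
    rw [ae_all_iff]; intro j
    filter_upwards [hae (false, i, j) (Finset.mem_univ _), hsm] with x hx hs
    simp only [Bool.false_eq_true, if_false] at hx
    exact hx.congr fun k => hs _ _ _
  have hdiv : ∀ᵐ x ∂(volume.restrict (slab b)), ∀ k,
      divA (mat (fun i j => wd j (ξ k i)) x) (mat (fun i j => wd j (v k i)) x) = 0 := by
    rw [ae_all_iff]; intro k
    obtain ⟨Dξ, Dv, h1, h2, h3⟩ := hinc k
    have e1 : ∀ i j, wd j (ξ k i) = Dξ i j := fun i j => (h1 i j).wd_eq (isOpen_slab b)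
    have e2 : ∀ i j, wd j (v k i) = Dv i j := fun i j => (h2 i j).wd_eq (isOpen_slab b)
    filter_upwards [h3] with x hx
    simp only [e1, e2]
    exact hx.2
  refine Lp.ext ?_
  have hsum : ∀ᵐ x ∂(volume.restrict (slab b)),
      (∑ i, wd i (v' i) : L2 (slab b)) x = ∑ i, wd i (v' i) x := by
    rw [Fin.sum_univ_three]
    filter_upwards [Lp.coeFn_add (wd 0 (v' 0) + wd 1 (v' 1)) (wd 2 (v' 2)),
      Lp.coeFn_add (wd 0 (v' 0)) (wd 1 (v' 1))] with x h1 h2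
    rw [h1, Pi.add_apply, h2, Fin.sum_univ_three]; rfl
  filter_upwards [hG, hV, hdiv, hsum, Lp.coeFn_zero ℝ 2 (volume.restrict (slab b))]
    with x h1 h2 h3 h4 h5
  rw [h4, h5]
  have hlim := tendsto_divA (G := fun k => mat (fun i j => wd j (ξ (ns k) i)) x)
    (V := fun k => (ε (ns k))⁻¹ • mat (fun i j => wd j (v (ns k) i)) x)
    (V' := mat (fun i j => wd j (v' i)) x)
    (tendsto_pi_nhds.2 fun i => tendsto_pi_nhds.2 fun j => h1 i j)
    (tendsto_pi_nhds.2 fun i => tendsto_pi_nhds.2 fun j => h2 i j)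
  -- `divA` is linear in the velocity gradient, so rescaling by `ε⁻¹` keeps it zero.
  refine tendsto_nhds_unique hlim (tendsto_const_nhds.congr fun k => ?_)
  have := h3 (ns k)
  simp only [divA, Matrix.smul_apply, smul_eq_mul] at this ⊢
  simp only [mul_left_comm _ (ε (ns k))⁻¹, ← Finset.mul_sum]
  rw [this]; simp

/-! ### Expansions in powers of the amplitude -/

lemma BoundedInE.norm_wd_le {b σ : ℝ} {C : ℝ≥0} {K : ℝ → ℝ≥0} {v : ℝ → VF b}
    (h : BoundedInE b σ C K v) {t : ℝ} (ht : 0 ≤ t) (i j : Fin 3) :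
    ‖wd i (v t j)‖ ≤ √C := by
  have h1 : ‖wd i (v t j)‖ₑ ≤ ENNReal.ofReal (√C) := by
    refine (enorm_wd_le_tanSqV b le_rfl 3 (v t) i j).trans ?_
    rw [Real.sqrt_eq_rpow, ← ENNReal.ofReal_rpow_of_nonneg (NNReal.coe_nonneg C) (by norm_num : (0 : ℝ) ≤ 1 / 2),
      ENNReal.ofReal_coe_nnreal]
    gcongr
    exact h.bdd t ht
  rw [← ofReal_norm] at h1
  exact (ENNReal.ofReal_le_ofReal_iff (Real.sqrt_nonneg _)).1 h1

lemma wd_expansion {b : ℝ} {v v₁ v₂ v₃ : VF b} {ε : ℝ} {i j : Fin 3}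
    (h₁ : IsWeakDeriv (slab b) i (v₁ j) (wd i (v₁ j)))
    (h₂ : IsWeakDeriv (slab b) i (v₂ j) (wd i (v₂ j)))
    (h₃ : IsWeakDeriv (slab b) i (v₃ j) (wd i (v₃ j)))
    (h : v = ε • v₁ + ε ^ 2 • v₂ + ε ^ 3 • v₃) :
    wd i (v j) = ε • wd i (v₁ j) + ε ^ 2 • wd i (v₂ j) + ε ^ 3 • wd i (v₃ j) := by
  rw [h]
  exact (((h₁.smul ε).add (h₂.smul (ε ^ 2))).add (h₃.smul (ε ^ 3))).wd_eq (isOpen_slab b)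

lemma topPairing_expansion {b : ℝ} {v v₁ v₂ v₃ : VF b} {ε : ℝ}
    (h₁ : IsWeakDeriv (slab b) 0 (v₁ 0) (wd 0 (v₁ 0)))
    (h₂ : IsWeakDeriv (slab b) 0 (v₂ 0) (wd 0 (v₂ 0)))
    (h₃ : IsWeakDeriv (slab b) 0 (v₃ 0) (wd 0 (v₃ 0)))
    (h : v = ε • v₁ + ε ^ 2 • v₂ + ε ^ 3 • v₃) {ψ : Eu 2 → ℝ} (hψ : IsTest univ ψ) :
    topPairing b hψ (v 0) = ε * topPairing b hψ (v₁ 0) + ε ^ 2 * topPairing b hψ (v₂ 0)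
      + ε ^ 3 * topPairing b hψ (v₃ 0) := by
  have hv : v 0 = ε • v₁ 0 + ε ^ 2 • v₂ 0 + ε ^ 3 • v₃ 0 := by rw [h]; rfl
  simp only [topPairing]
  rw [wd_expansion h₁ h₂ h₃ h, hv]
  simp only [inner_add_right, inner_smul_right]
  ring

lemma tendsto_topPairing_of_onTop {b : ℝ} (hb : 0 < b) {ψ : Eu 2 → ℝ} (hψ : IsTest univ ψ)
    {s : ℕ} {ι : Type*} {l : Filter ι} {u : ι → L2 (slab b)}
    (h : Tendsto (fun t => onTop b (sobSq univ s) (u t)) l (𝓝 0)) :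
    Tendsto (fun t => topPairing b hψ (u t)) l (𝓝 0) := by
  set C : ℝ≥0 := ‖toSurf (hψ.memLp 2 volume)‖₊ + 1 with hC
  have key : ∀ u : L2 (slab b),
      ‖topPairing b hψ u‖ₑ ≤ C * onTop b (sobSq univ s) u ^ (1 / 2 : ℝ) := by
    intro u
    refine le_mul_biInf_rpow_half (by positivity) fun g hg _ => ?_
    rw [hg.topPairing_eq hb hψ]
    refine (enorm_inner_le _ _).trans (mul_le_mul' ?_ (le_rpow_half_of_sq_le
      (enorm_sq_le_sobSq univ s g)))
    rw [hC]; push_cast; exact le_self_add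
  have h0 : Tendsto (fun t => (C : ℝ≥0∞) * onTop b (sobSq univ s) (u t) ^ (1 / 2 : ℝ)) l (𝓝 0) := by
    have h1 := (ENNReal.continuous_rpow_const (y := (1 / 2 : ℝ))).tendsto 0
    rw [ENNReal.zero_rpow_of_pos (by norm_num)] at h1
    have h2 := ENNReal.Tendsto.const_mul (a := (C : ℝ≥0∞)) (h1.comp h) (Or.inr ENNReal.coe_ne_top)
    rwa [mul_zero] at h2
  rw [tendsto_iff_edist_tendsto_0]
  refine tendsto_of_tendsto_of_tendsto_of_le_of_le tendsto_const_nhds h0 (fun _ => zero_le)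
    fun t => ?_
  rw [edist_eq_enorm_sub, sub_zero]
  exact key _

/-- The `L¹`-in-time seminorm makes the bound independent of `t`, which permits `t → ∞` at fixed `ε`
before `ε → 0`. -/
lemma norm_integral_topPairing_le {b σ : ℝ} {C : ℝ≥0} {K : ℝ → ℝ≥0} {v : ℝ → VF b}
    (h : BoundedInE b σ C K v) {ψ : Eu 2 → ℝ} (hψ : IsTest univ ψ) {D : ℝ≥0}
    (hD : ∀ t, 0 ≤ t → ‖topPairing b hψ (v t 0)‖ₑ
      ≤ D * onLambda b σ (tanSqV b 2 2) (v t) ^ (1 / 2 : ℝ)) {t : ℝ} (ht : 0 ≤ t) :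
    |∫ τ in (0 : ℝ)..t, topPairing b hψ (v τ 0)| ≤ D * C := by
  have h1 : ‖∫ τ in (0 : ℝ)..t, topPairing b hψ (v τ 0)‖ₑ ≤ (D * C : ℝ≥0) := by
    rw [intervalIntegral.integral_of_le ht]
    refine (enorm_integral_le_lintegral_enorm _).trans ?_
    calc _ ≤ ∫⁻ τ in Ioc 0 t, D * onLambda b σ (tanSqV b 2 2) (v τ) ^ (1 / 2 : ℝ) :=
          setLIntegral_mono' measurableSet_Ioc fun τ hτ => hD τ hτ.1.le
      _ ≤ ∫⁻ τ in Ici 0, D * onLambda b σ (tanSqV b 2 2) (v τ) ^ (1 / 2 : ℝ) :=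
          lintegral_mono_set fun τ hτ => hτ.1.le
      _ = D * ∫⁻ τ in Ici 0, onLambda b σ (tanSqV b 2 2) (v τ) ^ (1 / 2 : ℝ) :=
          lintegral_const_mul' _ _ ENNReal.coe_ne_top
      _ ≤ D * C := by gcongr; exact h.l1
      _ = _ := by push_cast; rfl
  rw [← ofReal_norm, ← ENNReal.ofReal_coe_nnreal, ENNReal.ofReal_le_ofReal_iff (by positivity)] at h1
  simpa using h1

lemma le_of_forall_small {a D₁ D₂ D₃ ε₀ : ℝ} (hε₀ : 0 < ε₀)
    (h : ∀ ε, 0 < ε → ε < ε₀ → ε * a ≤ ε * D₁ + ε ^ 2 * D₂ + ε ^ 3 * D₃) : a ≤ D₁ := by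
  have h1 : Tendsto (fun ε : ℝ => D₁ + ε * D₂ + ε ^ 2 * D₃) (𝓝[>] 0) (𝓝 (D₁ + 0 * D₂ + 0 ^ 2 * D₃)) :=
    ((by fun_prop : Continuous fun ε : ℝ => D₁ + ε * D₂ + ε ^ 2 * D₃).tendsto 0).mono_left
      nhdsWithin_le_nhds
  have h2 : a ≤ D₁ + 0 * D₂ + 0 ^ 2 * D₃ := by
    refine ge_of_tendsto h1 ?_
    filter_upwards [Ioo_mem_nhdsGT hε₀] with ε hε
    refine le_of_mul_le_mul_left ?_ hε.1
    have := h ε hε.1 hε.2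
    linarith
  linarith

/-- The first order velocity is divergence free. -/
theorem sum_wd_first_order_eq_zero {b σ ε₀ : ℝ} {θ : VF b}
    (hθ : ∀ i j, IsWeakDeriv (slab b) i (θ j) (wd i (θ j)))
    {v ξ : ℝ → ℝ → VF b} {v₁ v₂ : ℝ → VF b} {v₃ : ℝ → ℝ → VF b} {C : ℝ≥0} {K : ℝ → ℝ≥0}
    (hε₀ : 0 < ε₀) (h₁ : MemE b σ v₁) (h₂ : MemE b σ v₂)
    (hv : ∀ ε, 0 < ε → ε < ε₀ → ContIn (tanSqV b 1 3) (v ε))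
    (h₃ : ∀ ε, 0 < ε → ε < ε₀ → BoundedInE b σ C K (v₃ ε))
    (hk : ∀ ε, 0 < ε → ε < ε₀ → ∀ t, 0 ≤ t → ∀ i,
      HasDerivWithinAt (fun s => ξ ε s i) (v ε t i) (Ici 0) t)
    (hinit : ∀ ε, 0 < ε → ε < ε₀ → ξ ε 0 = ε • θ)
    (hinc : ∀ ε, 0 < ε → ε < ε₀ → ∀ t, 0 ≤ t → Incompressible b (ξ ε t) (v ε t))
    (hexp : ∀ ε, 0 < ε → ε < ε₀ → ∀ t, 0 ≤ t →
      v ε t = ε • v₁ t + ε ^ 2 • v₂ t + ε ^ 3 • v₃ ε t) {t : ℝ} (ht : 0 ≤ t) :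
    ∑ i, wd i (v₁ t i) = 0 := by
  obtain ⟨C₁, K₁, h₁⟩ := h₁
  obtain ⟨C₂, K₂, h₂⟩ := h₂
  -- The amplitudes `δ / (k + 1)` stay below `ε₀`, and being at most `1` they satisfy `ε², ε³ ≤ ε`.
  set δ := min ε₀ 1 / 2 with hδ
  have hmin : 0 < min ε₀ 1 := lt_min hε₀ one_pos
  have hδ0 : 0 < δ := by positivity
  have hδε : δ < ε₀ := by have := min_le_left ε₀ 1; linarith
  have hδ1 : δ ≤ 1 := by have := min_le_right ε₀ 1; linarith
  set e : ℕ → ℝ := fun k => δ / (k + 1) with he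
  have he0 : ∀ k, 0 < e k := fun k => by simp only [he]; positivity
  have heδ : ∀ k, e k ≤ δ := fun k => div_le_self hδ0.le (by
    have : (0 : ℝ) ≤ k := by positivity
    linarith)
  have heε : ∀ k, e k < ε₀ := fun k => (heδ k).trans_lt hδε
  have he1 : ∀ k, e k ≤ 1 := fun k => (heδ k).trans hδ1
  have helim : Tendsto e atTop (𝓝 0) :=
    (tendsto_const_nhds.div_atTop (tendsto_atTop_add_const_right _ 1 tendsto_natCast_atTop_atTop))
  have hwd : ∀ k τ, 0 ≤ τ → ∀ i j, wd i (v (e k) τ j) = e k • wd i (v₁ τ j)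
      + e k ^ 2 • wd i (v₂ τ j) + e k ^ 3 • wd i (v₃ (e k) τ j) := fun k τ hτ i j =>
    wd_expansion (h₁.cont.isWeakDeriv le_rfl hτ i j) (h₂.cont.isWeakDeriv le_rfl hτ i j)
      ((h₃ _ (he0 k) (heε k)).cont.isWeakDeriv le_rfl hτ i j) (hexp _ (he0 k) (heε k) τ hτ)
  have hp2 : ∀ k, e k ^ 2 ≤ e k := fun k => by
    rw [sq]; exact mul_le_of_le_one_left (he0 k).le (he1 k)
  have hp3 : ∀ k, e k ^ 3 ≤ e k := fun k => by
    rw [pow_succ]; exact mul_le_of_le_one_left (he0 k).le (pow_le_one₀ (he0 k).le (he1 k))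
  refine sum_wd_eq_zero_of_incompressible (ε := e) (ξ := fun k => ξ (e k) t)
    (v := fun k => v (e k) t) (v' := v₁ t) (fun i j => ?_) (fun i j => ?_)
    fun k => hinc _ (he0 k) (heε k) t ht
  · set A := √C₁ + √C₂ + √C with hA
    have hb1 : ∀ k τ, 0 ≤ τ → ‖wd j (v (e k) τ i)‖ ≤ e k * A := by
      intro k τ hτ
      rw [hwd k τ hτ]
      have n1 := h₁.norm_wd_le hτ j i
      have n2 := h₂.norm_wd_le hτ j i
      have n3 := (h₃ _ (he0 k) (heε k)).norm_wd_le hτ j i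
      refine (norm_add₃_le).trans ?_
      rw [norm_smul, norm_smul, norm_smul, Real.norm_of_nonneg (he0 k).le,
        Real.norm_of_nonneg (by have := he0 k; positivity),
        Real.norm_of_nonneg (by have := he0 k; positivity), hA, mul_add, mul_add]
      exact add_le_add (add_le_add (mul_le_mul le_rfl n1 (norm_nonneg _) (he0 k).le)
        (mul_le_mul (hp2 k) n2 (norm_nonneg _) (he0 k).le))
        (mul_le_mul (hp3 k) n3 (norm_nonneg _) (he0 k).le)
    have hb2 : ∀ k, ‖wd j (ξ (e k) t i)‖ ≤ e k * (‖wd j (θ i)‖ + A * t) := by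
      intro k
      have h0' : ∀ i j, IsWeakDeriv (slab b) i (ξ (e k) 0 j) (e k • wd i (θ j) : L2 (slab b)) := by
        intro i j
        rw [hinit _ (he0 k) (heε k)]
        exact (hθ i j).smul (e k)
      have h0 : ∀ i j, IsWeakDeriv (slab b) i (ξ (e k) 0 j) (wd i (ξ (e k) 0 j)) := by
        intro i j
        rw [(h0' i j).wd_eq (isOpen_slab b)]; exact h0' i j
      have := norm_wd_flow_le (hv _ (he0 k) (heε k)) (hk _ (he0 k) (heε k)) h0 ht j i (hb1 k)
      rw [(h0' j i).wd_eq (isOpen_slab b), norm_smul, Real.norm_of_nonneg (he0 k).le] at this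
      linarith
    refine squeeze_zero_norm hb2 ?_
    have := helim.mul_const (‖wd j (θ i)‖ + A * t)
    rwa [zero_mul] at this
  · rw [tendsto_iff_norm_sub_tendsto_zero]
    have hb3 : ∀ k, ‖(e k)⁻¹ • wd j (v (e k) t i) - wd j (v₁ t i)‖ ≤ e k * (√C₂ + √C) := by
      intro k
      have hne := (he0 k).ne'
      have n2 := h₂.norm_wd_le ht j i
      have n3 := (h₃ _ (he0 k) (heε k)).norm_wd_le ht j i
      have e1 : (e k)⁻¹ • wd j (v (e k) t i) - wd j (v₁ t i)
          = e k • wd j (v₂ t i) + e k ^ 2 • wd j (v₃ (e k) t i) := by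
        rw [hwd k t ht, smul_add, smul_add, smul_smul, smul_smul, smul_smul, inv_mul_cancel₀ hne,
          one_smul, show (e k)⁻¹ * e k ^ 2 = e k by field_simp,
          show (e k)⁻¹ * e k ^ 3 = e k ^ 2 by field_simp]
        abel
      rw [e1]
      refine (norm_add_le _ _).trans ?_
      rw [norm_smul, norm_smul, Real.norm_of_nonneg (he0 k).le,
        Real.norm_of_nonneg (by have := he0 k; positivity), mul_add]
      exact add_le_add (mul_le_mul le_rfl n2 (norm_nonneg _) (he0 k).le)
        (mul_le_mul (hp2 k) n3 (norm_nonneg _) (he0 k).le)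
    refine squeeze_zero (fun _ => norm_nonneg _) hb3 ?_
    have := helim.mul_const (√C₂ + √C)
    rwa [zero_mul] at this

/-- The trace of `θ¹` on the top, tested against `ψ`, is bounded by the negative norms of
`∂_h ψ`. -/
theorem abs_topPairing_data_le {b σ ε₀ : ℝ} (hb : 0 < b) (hσ : 0 < σ) (hσ1 : σ < 1) {θ : VF b}
    (hθ : ∀ i j, IsWeakDeriv (slab b) i (θ j) (wd i (θ j)))
    {v ξ : ℝ → ℝ → VF b} {v₁ v₂ : ℝ → VF b} {v₃ : ℝ → ℝ → VF b} {C C₁ : ℝ≥0} {K K₁ : ℝ → ℝ≥0}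
    (hε₀ : 0 < ε₀) (h₁ : BoundedInE b σ C₁ K₁ v₁) (h₂ : MemE b σ v₂)
    (hv : ∀ ε, 0 < ε → ε < ε₀ → ContIn (tanSqV b 1 3) (v ε))
    (h₃ : ∀ ε, 0 < ε → ε < ε₀ → BoundedInE b σ C K (v₃ ε))
    (hk : ∀ ε, 0 < ε → ε < ε₀ → ∀ t, 0 ≤ t → ∀ i,
      HasDerivWithinAt (fun s => ξ ε s i) (v ε t i) (Ici 0) t)
    (hinit : ∀ ε, 0 < ε → ε < ε₀ → ξ ε 0 = ε • θ)
    (hinc : ∀ ε, 0 < ε → ε < ε₀ → ∀ t, 0 ≤ t → Incompressible b (ξ ε t) (v ε t))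
    (hexp : ∀ ε, 0 < ε → ε < ε₀ → ∀ t, 0 ≤ t →
      v ε t = ε • v₁ t + ε ^ 2 • v₂ t + ε ^ 3 • v₃ ε t)
    (hdecay : ∀ ε, 0 < ε → ε < ε₀ →
      Tendsto (fun t => onTop b (sobSq univ 2) (ξ ε t 0)) atTop (𝓝 0))
    {ψ : Eu 2 → ℝ} (hψ : IsTest univ ψ) {D : ℝ≥0} (hD : D ≠ 0)
    (hDψ : √b * (lamNorm σ (pd 0 ψ) + lamNorm σ (pd 1 ψ)) ≤ D) :
    |topPairing b hψ (θ 0)| ≤ D * C₁ := by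
  have hdiv : ∀ t, 0 ≤ t → ∑ i, wd i (v₁ t i) = 0 := fun t ht =>
    sum_wd_first_order_eq_zero hθ hε₀ ⟨C₁, K₁, h₁⟩ h₂ hv h₃ hk hinit hinc hexp ht
  obtain ⟨C₂, K₂, h₂⟩ := h₂
  obtain ⟨E, hE⟩ := exists_enorm_topPairing_le hb hσ hσ1 hψ
  -- The constant `E` may depend on `ψ` in an uncontrolled way, since it comes with `ε²` and `ε³`.
  -- The sharp constant `D` is needed only for `v₁`, the one term known to be divergence free.
  refine le_of_forall_small hε₀ (D₂ := E * C₂) (D₃ := E * C) fun ε hε hεε₀ => ?_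
  have h₃' := h₃ ε hε hεε₀
  have b₁ : ∀ t, 0 ≤ t → |∫ τ in (0 : ℝ)..t, topPairing b hψ (v₁ τ 0)| ≤ D * C₁ := fun t ht =>
    norm_integral_topPairing_le h₁ hψ (fun t ht => enorm_topPairing_le_of_divFree hb hσ hσ1 hψ hD
      hDψ (h₁.cont.isWeakDeriv le_rfl ht) (h₁.bottom t ht 0) (hdiv t ht)) ht
  have b₂ : ∀ t, 0 ≤ t → |∫ τ in (0 : ℝ)..t, topPairing b hψ (v₂ τ 0)| ≤ E * C₂ := fun t ht =>
    norm_integral_topPairing_le h₂ hψ (fun t ht => hE _ (h₂.cont.isWeakDeriv le_rfl ht 0 0)) ht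
  have b₃ : ∀ t, 0 ≤ t → |∫ τ in (0 : ℝ)..t, topPairing b hψ (v₃ ε τ 0)| ≤ E * C := fun t ht =>
    norm_integral_topPairing_le h₃' hψ (fun t ht => hE _ (h₃'.cont.isWeakDeriv le_rfl ht 0 0)) ht
  have h0' : ∀ i j, IsWeakDeriv (slab b) i (ξ ε 0 j) (ε • wd i (θ j) : L2 (slab b)) := by
    intro i j
    rw [hinit ε hε hεε₀]
    exact (hθ i j).smul ε
  have h0 : ∀ i j, IsWeakDeriv (slab b) i (ξ ε 0 j) (wd i (ξ ε 0 j)) := by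
    intro i j
    rw [(h0' i j).wd_eq (isOpen_slab b)]; exact h0' i j
  have hξ0 : topPairing b hψ (ξ ε 0 0) = ε * topPairing b hψ (θ 0) := by
    rw [topPairing, (h0' 0 0).wd_eq (isOpen_slab b), hinit ε hε hεε₀, Pi.smul_apply,
      inner_smul_right, inner_smul_right, topPairing]
    ring
  have hlim := (tendsto_topPairing_of_onTop hb hψ (hdecay ε hε hεε₀)).abs
  rw [abs_zero] at hlim
  have hlim2 := hlim.add_const (ε * (D * C₁) + ε ^ 2 * (E * C₂) + ε ^ 3 * (E * C))
  rw [zero_add] at hlim2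
  -- At fixed `ε` the displacement term disappears as `t → ∞`, while the bounds on the three
  -- integrals do not depend on `t`.
  refine ge_of_tendsto hlim2 ?_
  filter_upwards [eventually_ge_atTop 0] with t ht
  have hflow := topPairing_flow (hv ε hε hεε₀) (hk ε hε hεε₀) h0 hψ ht
  have i₁ := intervalIntegrable_of_continuousOn_Ici (continuousOn_topPairing h₁.cont hψ) ht
  have i₂ := intervalIntegrable_of_continuousOn_Ici (continuousOn_topPairing h₂.cont hψ) ht
  have i₃ := intervalIntegrable_of_continuousOn_Ici (continuousOn_topPairing h₃'.cont hψ) ht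
  have hI : ∫ τ in (0 : ℝ)..t, topPairing b hψ (v ε τ 0)
      = ε * (∫ τ in (0 : ℝ)..t, topPairing b hψ (v₁ τ 0))
        + ε ^ 2 * (∫ τ in (0 : ℝ)..t, topPairing b hψ (v₂ τ 0))
        + ε ^ 3 * ∫ τ in (0 : ℝ)..t, topPairing b hψ (v₃ ε τ 0) := by
    rw [← intervalIntegral.integral_const_mul, ← intervalIntegral.integral_const_mul,
      ← intervalIntegral.integral_const_mul, ← intervalIntegral.integral_add (i₁.const_mul _)
      (i₂.const_mul _), ← intervalIntegral.integral_add ((i₁.const_mul _).add (i₂.const_mul _))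
      (i₃.const_mul _)]
    refine intervalIntegral.integral_congr fun τ hτ => ?_
    rw [uIcc_of_le ht] at hτ
    exact topPairing_expansion (h₁.cont.isWeakDeriv le_rfl hτ.1 0 0)
      (h₂.cont.isWeakDeriv le_rfl hτ.1 0 0) (h₃'.cont.isWeakDeriv le_rfl hτ.1 0 0)
      (hexp ε hε hεε₀ τ hτ.1) hψ
  rw [hξ0, hI] at hflow
  have b₁ := b₁ t ht
  have b₂ := b₂ t ht
  have b₃ := b₃ t ht
  set X₁ := ∫ τ in (0 : ℝ)..t, topPairing b hψ (v₁ τ 0)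
  set X₂ := ∫ τ in (0 : ℝ)..t, topPairing b hψ (v₂ τ 0)
  set X₃ := ∫ τ in (0 : ℝ)..t, topPairing b hψ (v₃ ε τ 0)
  have e1 : ε * |topPairing b hψ (θ 0)| = |ε * topPairing b hψ (θ 0)| := by
    rw [abs_mul, abs_of_pos hε]
  have e2 : ε * topPairing b hψ (θ 0)
      = topPairing b hψ (ξ ε t 0) - (ε * X₁ + ε ^ 2 * X₂ + ε ^ 3 * X₃) := by
    rw [hflow]; ring
  rw [e1, e2]
  refine (abs_sub _ _).trans (add_le_add le_rfl ?_)
  refine (abs_add_three _ _ _).trans ?_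
  rw [abs_mul, abs_mul, abs_mul, abs_of_pos hε, abs_of_pos (by positivity : 0 < ε ^ 2),
    abs_of_pos (by positivity : 0 < ε ^ 3)]
  gcongr

/-! ### Families closed under weak differentiation -/

/-- A set of square integrable functions which is closed under weak differentiation. -/
def DerivClosed {n : ℕ} {U : Set (Eu n)} (S : Set (L2 U)) : Prop :=
  ∀ u ∈ S, ∀ i, ∃ w ∈ S, IsWeakDeriv U i u w

lemma DerivClosed.exists_iterDeriv {n : ℕ} {U : Set (Eu n)} {S : Set (L2 U)} (hS : DerivClosed S)
    {u : L2 U} (hu : u ∈ S) (l : List (Fin n)) : ∃ w ∈ S, IsIterDeriv U l u w := by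
  induction l with
  | nil => exact ⟨u, hu, rfl⟩
  | cons i l ih =>
    obtain ⟨z, hz, h⟩ := ih
    obtain ⟨w, hw, h'⟩ := hS z hz i
    exact ⟨w, hw, z, h, h'⟩

/-- The Sobolev-type norms here are finite sums of nested `onDeriv` terms, so closure under
differentiation gives membership in all of them without any estimate. -/
lemma DerivClosed.onDeriv_lt_top {n : ℕ} {U : Set (Eu n)} {S : Set (L2 U)} (hS : DerivClosed S)
    {u : L2 U} (hu : u ∈ S) (l : List (Fin n)) {N : L2 U → ℝ≥0∞} (hN : ∀ w ∈ S, N w < ⊤) :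
    onDeriv U l N u < ⊤ := by
  obtain ⟨w, hw, h⟩ := hS.exists_iterDeriv hu l
  exact (iInf₂_le w h).trans_lt (hN w hw)

lemma DerivClosed.sobSq_lt_top {n : ℕ} {U : Set (Eu n)} {S : Set (L2 U)} (hS : DerivClosed S)
    {u : L2 U} (hu : u ∈ S) (s : ℕ) : sobSq U s u < ⊤ :=
  ENNReal.sum_lt_top.2 fun _ _ => ENNReal.sum_lt_top.2 fun _ _ =>
    hS.onDeriv_lt_top hu _ fun _ _ => ENNReal.pow_lt_top enorm_lt_top

lemma DerivClosed.tanSq_lt_top {b : ℝ} {S : Set (L2 (slab b))} (hS : DerivClosed S)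
    {u : L2 (slab b)} (hu : u ∈ S) (s N : ℕ) : tanSq b s N u < ⊤ :=
  ENNReal.sum_lt_top.2 fun _ _ => ENNReal.sum_lt_top.2 fun _ _ =>
    hS.onDeriv_lt_top hu _ fun _ hw => hS.sobSq_lt_top hw s

lemma memCirc_of_derivClosed {b : ℝ} {S : Set (L2 (slab b))} (hS : DerivClosed S)
    {T : Set Surf} (hT : DerivClosed T) {f : VF b} (hf : ∀ j, f j ∈ S) {g : Surf} (hg : g ∈ T)
    (htr : IsTraceTop b (f 0) g) (N : ℕ) : MemCirc b N f := by
  refine ⟨ENNReal.sum_lt_top.2 fun j _ => hS.tanSq_lt_top (hf j) _ _, ?_⟩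
  refine ENNReal.sum_lt_top.2 fun _ _ => ENNReal.sum_lt_top.2 fun _ _ => ENNReal.add_lt_top.2 ⟨?_, ?_⟩
  · exact (iInf₂_le g htr).trans_lt (hT.onDeriv_lt_top hg _ fun _ hw => hT.sobSq_lt_top hw 1)
  · exact ENNReal.sum_lt_top.2 fun j _ => ENNReal.sum_lt_top.2 fun _ _ =>
      hS.onDeriv_lt_top (hf j) _ fun _ hw => hS.sobSq_lt_top hw 1

/-! ### Functions independent of the vertical variable -/

lemma isWeakDeriv_toLp {n : ℕ} {U : Set (Eu n)} {f : Eu n → ℝ}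
    (hf : ContDiff ℝ ∞ f) {i : Fin n} (h2 : MemLp f 2 (volume.restrict U))
    (h2' : MemLp (pd i f) 2 (volume.restrict U)) :
    IsWeakDeriv U i (h2.toLp f) (h2'.toLp (pd i f)) := by
  refine ⟨locallyIntegrableOn_L2 _, locallyIntegrableOn_L2 _, fun φ hφ => ?_⟩
  have e1 : ∫ x in U, (h2.toLp f) x * pd i φ x = ∫ x in U, f x * pd i φ x :=
    integral_congr_ae (by filter_upwards [h2.coeFn_toLp] with x hx; rw [hx])
  have e2 : ∫ x in U, (h2'.toLp (pd i f)) x * φ x = ∫ x in U, pd i f x * φ x :=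
    integral_congr_ae (by filter_upwards [h2'.coeFn_toLp] with x hx; rw [hx])
  have z : ∀ {g : Eu n → ℝ}, tsupport g ⊆ U → ∀ x ∉ U, g x = 0 := fun hg x hx =>
    image_eq_zero_of_notMem_tsupport fun hh => hx (hg hh)
  rw [e1, e2, setIntegral_eq_integral_of_forall_compl_eq_zero,
    setIntegral_eq_integral_of_forall_compl_eq_zero]
  · have hd : ∀ {g : Eu n → ℝ}, ContDiff ℝ ∞ g → Differentiable ℝ g := fun hg =>
      hg.differentiable (by simp)
    refine integral_mul_fderiv_eq_neg_fderiv_mul_of_integrable ?_ ?_ ?_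
      (fun x _ => hd hf x) (fun x _ => hd hφ.1 x)
    · exact ((contDiff_pd hf i).continuous.mul hφ.1.continuous).integrable_of_hasCompactSupport
        hφ.2.1.mul_left
    · exact (hf.continuous.mul (hφ.pd i).1.continuous).integrable_of_hasCompactSupport
        (hφ.pd i).2.1.mul_left
    · exact (hf.continuous.mul hφ.1.continuous).integrable_of_hasCompactSupport hφ.2.1.mul_left
  · intro x hx; rw [z hφ.2.2 x hx, mul_zero]
  · intro x hx; rw [z (hφ.pd i).2.2 x hx, mul_zero]

/-- The function `x ↦ u(x_h)` on the slab. -/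
def vconst (b : ℝ) (u : Surf) : L2 (slab b) := tens b (continuous_const (X := ℝ) (y := (1 : ℝ))) u

lemma continuous_vconst {b : ℝ} (hb : 0 ≤ b) : Continuous (vconst b) :=
  continuous_tens hb (continuous_const (X := ℝ) (y := (1 : ℝ)))

lemma vconst_ae (b : ℝ) (u : Surf) :
    ∀ᵐ x ∂(volume.restrict (slab b)), vconst b u x = u (hpart x) := by
  filter_upwards [tens_ae b (continuous_const (X := ℝ) (y := (1 : ℝ))) u] with x hx
  rw [vconst, hx, one_mul]

lemma memLp_vconst (b : ℝ) {ψ : Eu 2 → ℝ} (hψ : IsTest univ ψ) :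
    MemLp (fun x => (1 : ℝ) * ψ (hpart x)) 2 (volume.restrict (slab b)) :=
  memLp_tens b (continuous_const (X := ℝ) (y := (1 : ℝ))) (hψ.memLp 2 volume)

lemma vconst_toSurf (b : ℝ) {ψ : Eu 2 → ℝ} (hψ : IsTest univ ψ) :
    vconst b (toSurf (hψ.memLp 2 volume)) = (memLp_vconst b hψ).toLp _ := by
  refine Lp.ext ?_
  filter_upwards [tens_toSurf_ae b (continuous_const (X := ℝ) (y := (1 : ℝ))) (hψ.memLp 2 volume),
    (memLp_vconst b hψ).coeFn_toLp] with x h1 h2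
  rw [vconst, h1, h2]

lemma contDiff_vconst {ψ : Eu 2 → ℝ} (hψ : ContDiff ℝ ∞ ψ) :
    ContDiff ℝ ∞ (fun x => (1 : ℝ) * ψ (hpart x)) :=
  contDiff_const.mul (hψ.comp hpartL.contDiff)

lemma isWeakDeriv_zero_vconst_test (b : ℝ) {ψ : Eu 2 → ℝ} (hψ : IsTest univ ψ) :
    IsWeakDeriv (slab b) 0 (vconst b (toSurf (hψ.memLp 2 volume))) (0 : L2 (slab b)) := by
  have e : pd 0 (fun x => (1 : ℝ) * ψ (hpart x)) = 0 := by
    rw [pd_zero_prod (η := fun _ => 1) contDiff_const hψ.1]; ext x; simp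
  have h := isWeakDeriv_toLp (contDiff_vconst hψ.1) (i := 0) (memLp_vconst b hψ)
    (by rw [e]; exact MemLp.zero)
  rw [vconst_toSurf b hψ]
  convert h using 1
  have e' : ∀ (f : Eu 3 → ℝ) (hf : MemLp f 2 (volume.restrict (slab b))), f = 0 → hf.toLp f = 0 := by
    rintro f hf rfl; exact MemLp.toLp_zero hf
  rw [e' _ _ e]

lemma isWeakDeriv_succ_vconst_test (b : ℝ) (j : Fin 2) {ψ : Eu 2 → ℝ} (hψ : IsTest univ ψ) :
    IsWeakDeriv (slab b) j.succ (vconst b (toSurf (hψ.memLp 2 volume)))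
      (vconst b (toSurf ((hψ.pd j).memLp 2 volume))) := by
  have e : pd j.succ (fun x => (1 : ℝ) * ψ (hpart x)) = fun x => 1 * pd j ψ (hpart x) :=
    pd_succ_prod (η := fun _ => 1) contDiff_const hψ.1 j
  have h := isWeakDeriv_toLp (contDiff_vconst hψ.1) (i := j.succ) (memLp_vconst b hψ)
    (by rw [e]; exact memLp_vconst b (hψ.pd j))
  rw [vconst_toSurf b hψ, vconst_toSurf b (hψ.pd j)]
  convert h using 2
  exact congrArg _ (by congr 1; exact e.symm)

/-- For fixed right side the weak derivative condition is closed in `u`, so density of test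
functions suffices. -/
lemma isWeakDeriv_zero_vconst {b : ℝ} (hb : 0 ≤ b) (u : Surf) :
    IsWeakDeriv (slab b) 0 (vconst b u) (0 : L2 (slab b)) := by
  refine dense_test_surf.induction (P := fun u => IsWeakDeriv (slab b) 0 (vconst b u) (0 : L2 (slab b)))
    ?_ ?_ u
  · rintro _ ⟨ψ, hψ, rfl⟩
    exact isWeakDeriv_zero_vconst_test b hψ
  · simp only [isWeakDeriv_iff, ofPred_forall]
    exact isClosed_iInter fun φ => isClosed_iInter fun hφ =>
      isClosed_eq (continuous_const.inner (continuous_vconst hb)) continuous_const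

lemma isWeakDeriv_test_surf (j : Fin 2) {ψ : Eu 2 → ℝ} (hψ : IsTest univ ψ) :
    IsWeakDeriv univ j (toSurf (hψ.memLp 2 volume)) (toSurf ((hψ.pd j).memLp 2 volume)) :=
  isWeakDeriv_toLp hψ.1 _ _

/-- The trace of a function independent of the vertical variable. -/
theorem isTraceTop_vconst {b : ℝ} (hb : 0 < b) (u : Surf) : IsTraceTop b (vconst b u) u := by
  refine ⟨0, isWeakDeriv_zero_vconst hb.le u, fun φ hφ => ?_⟩
  have hu : MemLp u 2 volume := memLp_of_memLp_univ (Lp.memLp u)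
  have hint : IntegrableOn (fun x => u (hpart x) * pd 0 φ x) (slab b) := by
    have h1 := memLp_tens b (continuous_const (X := ℝ) (y := (1 : ℝ))) hu
    simp only [one_mul] at h1
    exact h1.integrable_mul ((hφ.pd 0).memLp 2 _)
  have e1 : ∫ x in slab b, (vconst b u x * pd 0 φ x + (0 : L2 (slab b)) x * φ x)
      = ∫ x in slab b, u (hpart x) * pd 0 φ x := by
    refine integral_congr_ae ?_
    filter_upwards [vconst_ae b u, Lp.coeFn_zero ℝ 2 (volume.restrict (slab b))] with x h1 h2
    rw [h1, h2]; simp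
  have hint' : Integrable (Function.uncurry fun (s : ℝ) (y : Eu 2) => u y * pd 0 φ (pt s y))
      (((volume : Measure ℝ).restrict (Ioo (-b) 0)).prod (volume : Measure (Eu 2))) := by
    have := ((measurePreserving_slab b).integrable_comp_emb ptEquiv.measurableEmbedding).2 hint
    refine this.congr (ae_of_all _ fun p => ?_)
    simp [ptEquiv_apply, Function.uncurry]
  rw [e1, setIntegral_slab hint]
  simp only [hpart_pt]
  rw [integral_integral_swap hint']
  refine integral_congr_ae (ae_of_all _ fun y => ?_)
  simp only
  rw [integral_const_mul]
  congr 1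
  have hd : ∀ s : ℝ, HasDerivAt (fun s => φ (pt s y)) (pd 0 φ (pt s y)) s := by
    intro s
    have h1 : HasDerivAt (fun s => pt s y) (EuclideanSpace.single 0 1) s := by
      have h2 : ∀ s, pt s y = s • (EuclideanSpace.single 0 1 : Eu 3) + pt 0 y := by
        intro s; ext i; fin_cases i <;> simp [pt]
      have h3 : (fun s => pt s y) = fun s => s • (EuclideanSpace.single 0 1 : Eu 3) + pt 0 y :=
        funext h2
      rw [h3]
      simpa using ((hasDerivAt_id s).smul_const (EuclideanSpace.single 0 1 : Eu 3)).add_const (pt 0 y)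
    exact ((hφ.1.differentiable (by simp) (pt s y)).hasFDerivAt).comp_hasDerivAt s h1
  have hcont : Continuous fun s => pd 0 φ (pt s y) := by
    refine (hφ.pd 0).1.continuous.comp ?_
    unfold pt; fun_prop
  -- The fundamental theorem of calculus along a vertical line; the lower endpoint contributes
  -- nothing because `φ` is supported strictly above the bottom.
  rw [← integral_Ioc_eq_integral_Ioo, ← intervalIntegral.integral_of_le (by linarith),
    intervalIntegral.integral_eq_sub_of_hasDerivAt (fun s _ => hd s)
      (hcont.intervalIntegrable _ _)]
  have hz : φ (pt (-b) y) = 0 := by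
    refine image_eq_zero_of_notMem_tsupport fun hh => ?_
    have h4 : -b < (pt (-b) y) 0 := hφ.2.2 hh
    simp at h4
  rw [hz, sub_zero]

/-! ### A slowly decaying profile -/

lemma isWeakDeriv_sum {n : ℕ} {U : Set (Eu n)} {i : Fin n} {ι : Type*} {u w : ι → L2 U}
    (h : ∀ k, IsWeakDeriv U i (u k) (w k)) (s : Finset ι) :
    IsWeakDeriv U i (∑ k ∈ s, u k : L2 U) (∑ k ∈ s, w k : L2 U) := by
  classical
  induction s using Finset.induction_on with
  | empty => simpa only [Finset.sum_empty] using isWeakDeriv_zero U i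
  | insert a s ha ih =>
    rw [Finset.sum_insert ha, Finset.sum_insert ha]
    exact (h a).add ih

lemma IsWeakDeriv.of_hasSum {n : ℕ} {U : Set (Eu n)} {i : Fin n} {ι : Type*} {u w : ι → L2 U}
    {u' w' : L2 U} (hu : HasSum u u') (hw : HasSum w w') (h : ∀ k, IsWeakDeriv U i (u k) (w k)) :
    IsWeakDeriv U i u' w' :=
  IsWeakDeriv.of_tendsto hu hw (isWeakDeriv_sum h)

/-- The embedding of functions on the plane into functions on the slab. -/
def vconstL {b : ℝ} (hb : 0 ≤ b) : Surf →L[ℝ] L2 (slab b) :=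
  (AddMonoidHom.ofMapSub (vconst b) (tens_sub b _)).toRealLinearMap (continuous_vconst hb)

@[simp] lemma vconstL_apply {b : ℝ} (hb : 0 ≤ b) (u : Surf) : vconstL hb u = vconst b u := rfl

/-! ### Dilations of test functions and their derivatives. -/

/-- The iterated classical partial derivative. -/
def pdl {n : ℕ} (l : List (Fin n)) (φ : Eu n → ℝ) : Eu n → ℝ := l.foldr pd φ

lemma IsTest.pdl {n : ℕ} {U : Set (Eu n)} {φ : Eu n → ℝ} (h : IsTest U φ) (l : List (Fin n)) :
    IsTest U (pdl l φ) := by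
  induction l with
  | nil => exact h
  | cons i l ih => exact ih.pd i

lemma pd_comp_smul {n : ℕ} (i : Fin n) (φ : Eu n → ℝ) (c : ℝ) :
    pd i (fun y => φ (c • y)) = fun y => c * pd i φ (c • y) := by
  ext y
  simp only [pd]
  rw [fderiv_comp_smul]
  simp

lemma pd_const_mul {n : ℕ} (i : Fin n) {φ : Eu n → ℝ} (hφ : ContDiff ℝ ∞ φ) (a : ℝ) :
    pd i (fun y => a * φ y) = fun y => a * pd i φ y := by
  ext y
  simp only [pd]
  rw [fderiv_const_mul (hφ.differentiable (by simp) y)]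
  simp

lemma IsTest.comp_smul {n : ℕ} {φ : Eu n → ℝ} (h : IsTest univ φ) {c : ℝ} (hc : c ≠ 0) :
    IsTest univ (fun y => φ (c • y)) :=
  ⟨h.1.comp (contDiff_const_smul c), h.2.1.comp_homeomorph (Homeomorph.smulOfNeZero c hc),
    subset_univ _⟩

lemma pdl_comp_smul {n : ℕ} {φ : Eu n → ℝ} (h : IsTest univ φ) {c : ℝ} (hc : c ≠ 0)
    (l : List (Fin n)) :
    pdl l (fun y => φ (c • y)) = fun y => c ^ l.length * pdl l φ (c • y) := by
  induction l with
  | nil => simp [pdl]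
  | cons i l ih =>
    change pd i (pdl l fun y => φ (c • y)) = _
    rw [ih, pd_const_mul i ((h.pdl l).comp_smul hc).1, pd_comp_smul]
    ext y
    rw [List.length_cons, pow_succ, mul_assoc]; rfl

lemma norm_toSurf {P : Eu 2 → ℝ} (hP : MemLp P 2 volume) :
    ‖toSurf hP‖ = (eLpNorm P 2 volume).toReal := by
  rw [toSurf, Lp.norm_toLp, Measure.restrict_univ]

lemma norm_toSurf_comp_smul {ψ : Eu 2 → ℝ} (h : IsTest univ ψ) {c : ℝ} (hc : 0 < c) :
    ‖toSurf ((h.comp_smul hc.ne').memLp 2 volume)‖ = c⁻¹ * ‖toSurf (h.memLp 2 volume)‖ := by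
  rw [norm_toSurf, norm_toSurf, eLpNorm_comp_smul hc, ENNReal.toReal_mul,
    ENNReal.toReal_ofReal (by positivity)]

/-- Each derivative of the dilate produces a factor `c ≤ 1`. Discarding these factors gives the same
rate `c⁻¹` for all orders. -/
lemma norm_toSurf_pdl_comp_smul_le {ψ : Eu 2 → ℝ} (h : IsTest univ ψ) {c : ℝ} (hc : 0 < c)
    (hc1 : c ≤ 1) (l : List (Fin 2)) :
    ‖toSurf (((h.comp_smul hc.ne').pdl l).memLp 2 volume)‖
      ≤ c⁻¹ * ‖toSurf ((h.pdl l).memLp 2 volume)‖ := by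
  rw [← norm_toSurf_comp_smul (h.pdl l) hc, norm_toSurf, norm_toSurf]
  refine ENNReal.toReal_mono (((h.pdl l).comp_smul hc.ne').memLp 2 volume).2.ne
    (eLpNorm_mono fun y => ?_)
  rw [pdl_comp_smul h hc.ne', norm_mul, Real.norm_of_nonneg (by positivity)]
  exact mul_le_of_le_one_left (norm_nonneg _) (pow_le_one₀ hc.le hc1)

/-! ### The dyadic series and its pairing with dilates. -/

/-- The derivative with multi-index `l` of the `n`-th term `2⁻ⁿ rⁿ ψ(2⁻ⁿ y)`. -/
def profileTerm {ψ : Eu 2 → ℝ} (h : IsTest univ ψ) (r : ℝ) (l : List (Fin 2)) (n : ℕ) : Surf :=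
  ((1 / 2 : ℝ) ^ n * r ^ n) •
    toSurf (((h.comp_smul (c := (1 / 2 : ℝ) ^ n) (by positivity)).pdl l).memLp 2 volume)

/-- The derivative with multi-index `l` of the profile `∑ₙ 2⁻ⁿ rⁿ ψ(2⁻ⁿ y)`. -/
def profile {ψ : Eu 2 → ℝ} (h : IsTest univ ψ) (r : ℝ) (l : List (Fin 2)) : Surf :=
  ∑' n, profileTerm h r l n

/-- The amplitude `2⁻ⁿ` cancels the growth `2ⁿ` of the `L²` norm of the dilate, which leaves a
geometric series in `r` for every derivative. -/
lemma hasSum_profile {ψ : Eu 2 → ℝ} (h : IsTest univ ψ) {r : ℝ} (hr : 0 ≤ r) (hr1 : r < 1)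
    (l : List (Fin 2)) : HasSum (profileTerm h r l) (profile h r l) := by
  refine Summable.hasSum (Summable.of_norm_bounded
    (g := fun n => r ^ n * ‖toSurf ((h.pdl l).memLp 2 volume)‖)
    ((summable_geometric_of_lt_one hr hr1).mul_right _) fun n => ?_)
  have hc : (0 : ℝ) < (1 / 2) ^ n := by positivity
  rw [profileTerm, norm_smul, Real.norm_of_nonneg (by positivity)]
  calc _ ≤ (1 / 2 : ℝ) ^ n * r ^ n *
        (((1 / 2 : ℝ) ^ n)⁻¹ * ‖toSurf ((h.pdl l).memLp 2 volume)‖) := by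
        gcongr
        exact norm_toSurf_pdl_comp_smul_le h hc (pow_le_one₀ (by norm_num) (by norm_num)) l
    _ = _ := by field_simp

lemma isWeakDeriv_profile {ψ : Eu 2 → ℝ} (h : IsTest univ ψ) {r : ℝ} (hr : 0 ≤ r) (hr1 : r < 1)
    (j : Fin 2) (l : List (Fin 2)) :
    IsWeakDeriv univ j (profile h r l) (profile h r (j :: l)) :=
  .of_hasSum (hasSum_profile h hr hr1 l) (hasSum_profile h hr hr1 (j :: l)) fun n =>
    (isWeakDeriv_test_surf j ((h.comp_smul (by positivity)).pdl l)).smul _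

lemma isWeakDeriv_vconst_profile {b : ℝ} (hb : 0 ≤ b) {ψ : Eu 2 → ℝ} (h : IsTest univ ψ) {r : ℝ}
    (hr : 0 ≤ r) (hr1 : r < 1) (j : Fin 2) (l : List (Fin 2)) :
    IsWeakDeriv (slab b) j.succ (vconst b (profile h r l)) (vconst b (profile h r (j :: l))) := by
  refine .of_hasSum ((hasSum_profile h hr hr1 l).mapL (vconstL hb))
    ((hasSum_profile h hr hr1 (j :: l)).mapL (vconstL hb)) fun n => ?_
  simp only [profileTerm, map_smul, vconstL_apply]
  exact (isWeakDeriv_succ_vconst_test b j ((h.comp_smul (by positivity)).pdl l)).smul _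

lemma derivClosed_profile {ψ : Eu 2 → ℝ} (h : IsTest univ ψ) {r : ℝ} (hr : 0 ≤ r) (hr1 : r < 1) :
    DerivClosed (range (profile h r)) := by
  rintro _ ⟨l, rfl⟩ j
  exact ⟨_, ⟨j :: l, rfl⟩, isWeakDeriv_profile h hr hr1 j l⟩

lemma derivClosed_vconst_profile {b : ℝ} (hb : 0 ≤ b) {ψ : Eu 2 → ℝ} (h : IsTest univ ψ) {r : ℝ}
    (hr : 0 ≤ r) (hr1 : r < 1) :
    DerivClosed (insert 0 (range fun l => vconst b (profile h r l))) := by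
  rintro _ (rfl | ⟨l, rfl⟩) i
  · exact ⟨0, mem_insert _ _, isWeakDeriv_zero _ i⟩
  · refine Fin.cases ?_ (fun j => ?_) i
    · exact ⟨0, mem_insert _ _, isWeakDeriv_zero_vconst hb _⟩
    · exact ⟨_, mem_insert_of_mem _ ⟨j :: l, rfl⟩, isWeakDeriv_vconst_profile hb h hr hr1 j l⟩

/-- As `ψ ≥ 0`, every term of the series pairs nonnegatively with the dilate, and only the matching
term `n = N` is kept. It contributes `c rᴺ` times the squared norm `c⁻² ‖ψ‖²` of the dilate. -/
lemma inner_profile_ge {ψ : Eu 2 → ℝ} (h : IsTest univ ψ) (hpos : ∀ y, 0 ≤ ψ y) {r : ℝ}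
    (hr : 0 ≤ r) (hr1 : r < 1) (N : ℕ) {c : ℝ} (hc : 0 < c) (hcN : c = (1 / 2) ^ N) :
    c⁻¹ * r ^ N * ‖toSurf (h.memLp 2 volume)‖ ^ 2 ≤
      inner ℝ (toSurf ((h.comp_smul hc.ne').memLp 2 volume)) (profile h r []) := by
  subst hcN
  set φ := toSurf ((h.comp_smul hc.ne').memLp 2 volume) with hφ
  have hs : HasSum (fun n => inner ℝ φ (profileTerm h r [] n)) (inner ℝ φ (profile h r [])) :=
    (hasSum_profile h hr hr1 []).mapL (innerSL ℝ φ)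
  have hnn : ∀ n, 0 ≤ (inner ℝ φ (profileTerm h r [] n) : ℝ) := by
    intro n
    rw [profileTerm, inner_smul_right, hφ, inner_toSurf]
    refine mul_nonneg (by positivity) (integral_nonneg_of_ae ?_)
    filter_upwards [toSurf_ae (((h.comp_smul (c := (1 / 2 : ℝ) ^ n) (by positivity)).pdl []).memLp
      2 volume)] with y hy
    rw [hy]
    exact mul_nonneg (hpos _) (hpos _)
  refine le_trans (le_of_eq ?_) (le_hasSum hs N fun n _ => hnn n)
  have e : profileTerm h r [] N = ((1 / 2 : ℝ) ^ N * r ^ N) • φ := rfl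
  rw [e, inner_smul_right, real_inner_self_eq_norm_sq, hφ, norm_toSurf_comp_smul h hc]
  field_simp

/-- The derivative improves the exponent `-1 - σ` to `-σ`. For `σ < 1` this is smaller than the
order `c⁻¹` of the pairing with the profile, up to powers of `r`; without the derivative it would be
larger. -/
lemma lamNorm_pd_comp_smul (σ : ℝ) (ψ : Eu 2 → ℝ) (j : Fin 2) {c : ℝ} (hc : 0 < c) :
    lamNorm σ (pd j fun y => ψ (c • y)) = c ^ (-σ) * lamNorm σ (pd j ψ) := by
  rw [pd_comp_smul, lamNorm_const_mul σ _ hc.le, lamNorm_comp_smul σ _ hc, ← mul_assoc]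
  congr 1
  rw [show -σ = 1 + (-1 - σ) by ring, Real.rpow_add hc, Real.rpow_one]

lemma exists_bump : ∃ ψ : Eu 2 → ℝ, ∃ h : IsTest univ ψ, (∀ y, 0 ≤ ψ y) ∧
    0 < ‖toSurf (h.memLp 2 volume)‖ := by
  let f : ContDiffBump (0 : Eu 2) := ⟨1, 2, one_pos, one_lt_two⟩
  have h : IsTest univ f := ⟨f.contDiff, f.hasCompactSupport, subset_univ _⟩
  refine ⟨f, h, fun y => f.nonneg, ?_⟩
  rw [norm_toSurf]
  refine ENNReal.toReal_pos ?_ (h.memLp 2 volume).2.ne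
  rw [Ne, eLpNorm_eq_zero_iff h.1.continuous.aestronglyMeasurable (by simp)]
  intro h0
  have h1 : (f : Eu 2 → ℝ) = 0 := h.1.continuous.ae_eq_iff_eq volume continuous_zero |>.1 h0
  have h2 : f 0 = 1 := f.one_of_mem_closedBall (by simp [f])
  rw [h1] at h2
  simp at h2

end ViscousSurface

end

/-! ### The contradiction for the slowly decaying profile. -/

theorem theorem3p2 (b ν σ₀ : ℝ) (hb : 0 < b) (hν : 0 < ν) (hσ : 1 / 2 < σ₀) (hσ' : σ₀ < 1) :
    ∃ θ : ViscousSurface.VF b,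
      ViscousSurface.MemCirc b 3 θ ∧ ViscousSurface.DivFree b θ ∧
      ¬ ∃ (ε₀ : ℝ) (v : ℝ → ℝ → ViscousSurface.VF b)
          (q : ℝ → ℝ → ViscousSurface.L2 (ViscousSurface.slab b))
          (ξ : ℝ → ℝ → ViscousSurface.VF b)
          (v₁ v₂ : ℝ → ViscousSurface.VF b) (v₃ : ℝ → ℝ → ViscousSurface.VF b)
          (C : ℝ≥0) (K : ℝ → ℝ≥0),
        0 < ε₀ ∧
        ViscousSurface.MemE b σ₀ v₁ ∧ ViscousSurface.MemE b σ₀ v₂ ∧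
        ∀ ε : ℝ, 0 < ε → ε < ε₀ →
          ViscousSurface.MemE b σ₀ (v ε) ∧
          ViscousSurface.MemPressure b (q ε) ∧
          ViscousSurface.MemDisplacement b (ξ ε) ∧
          ViscousSurface.IsSolution b ν (ε • θ) 0 (ξ ε) (v ε) (q ε) ∧
          Tendsto (fun t => ViscousSurface.onTop b
            (ViscousSurface.sobSq (univ : Set (ViscousSurface.Eu 2)) 2) (ξ ε t 0)) atTop (𝓝 0) ∧
          ViscousSurface.BoundedInE b σ₀ C K (v₃ ε) ∧
          ∀ t : ℝ, 0 ≤ t → v ε t = ε • v₁ t + ε ^ 2 • v₂ t + ε ^ 3 • v₃ ε t := by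
  open ViscousSurface in
  obtain ⟨ψ, hψ, hpos, hnorm⟩ := exists_bump
  have hσ0 : 0 < σ₀ := by linarith
  -- The choice makes `r² = 2^(σ₀-1)`, hence `c^(-σ₀) = c⁻¹ r²ᴺ` for `c = 2⁻ᴺ`. One factor `rᴺ` pays
  -- for the convergence of the profile and the other gives the contradiction.
  set r : ℝ := (2 : ℝ) ^ ((σ₀ - 1) / 2) with hr
  have hr0 : 0 < r := by positivity
  have hr1 : r < 1 := Real.rpow_lt_one_of_one_lt_of_neg one_lt_two (by linarith)
  -- A vertical field depending only on `x_h` is divergence free, and its trace on `Σ₀` is the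
  -- profile itself.
  set θ : VF b := fun j => if j = 0 then vconst b (profile hψ r []) else 0 with hθdef
  have hS := derivClosed_vconst_profile hb.le hψ hr0.le hr1
  have hmem : ∀ j, θ j ∈ insert 0 (range fun l => vconst b (profile hψ r l)) := by
    intro j
    simp only [hθdef]
    split_ifs
    · exact mem_insert_of_mem _ ⟨[], rfl⟩
    · exact mem_insert _ _
  have hθ0 : θ 0 = vconst b (profile hψ r []) := by simp [hθdef]
  have htr : IsTraceTop b (θ 0) (profile hψ r []) := by
    rw [hθ0]; exact isTraceTop_vconst hb _
  have hθ : ∀ i j, IsWeakDeriv (slab b) i (θ j) (wd i (θ j)) := by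
    intro i j
    obtain ⟨w, -, hw⟩ := hS _ (hmem j) i
    rw [hw.wd_eq (isOpen_slab b)]; exact hw
  refine ⟨θ, memCirc_of_derivClosed hS (derivClosed_profile hψ hr0.le hr1) hmem ⟨[], rfl⟩ htr 3,
    ⟨fun i j => wd j (θ i), fun i j => hθ j i, ?_⟩, ?_⟩
  · have h0 : wd 0 (θ 0) = 0 := by
      rw [hθ0]; exact (isWeakDeriv_zero_vconst hb.le _).wd_eq (isOpen_slab b)
    have h1 : ∀ i : Fin 3, i ≠ 0 → wd i (θ i) = 0 := by
      intro i hi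
      have : θ i = 0 := by simp [hθdef, hi]
      rw [this]; exact (isWeakDeriv_zero _ i).wd_eq (isOpen_slab b)
    have hz : ∀ i, wd i (θ i) = 0 := fun i => by
      by_cases hi : i = 0
      · rw [hi]; exact h0
      · exact h1 i hi
    filter_upwards [Lp.coeFn_zero ℝ 2 (volume.restrict (slab b))] with x hx
    refine Finset.sum_eq_zero fun i _ => ?_
    rw [hz i, hx]; rfl
  · rintro ⟨ε₀, v, q, ξ, v₁, v₂, v₃, C, K, hε₀, ⟨C₁, K₁, h₁⟩, h₂, H⟩
    set M : ℝ := √b * (lamNorm σ₀ (pd 0 ψ) + lamNorm σ₀ (pd 1 ψ)) with hM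
    have hM0 : 0 ≤ M := by
      have hn : ∀ φ, 0 ≤ lamNorm σ₀ φ := fun φ => ENNReal.toReal_nonneg
      exact mul_nonneg (Real.sqrt_nonneg b) (add_nonneg (hn _) (hn _))
    set A := ‖toSurf (hψ.memLp 2 volume)‖ ^ 2 with hA
    have key : ∀ N : ℕ, A ≤ ((M + 1) * C₁) * r ^ N := by
      intro N
      set c : ℝ := (1 / 2) ^ N with hc
      have hc0 : 0 < c := by positivity
      -- `M + 1` in place of `M` ensures `D ≠ 0`.
      set D : ℝ≥0 := ⟨(M + 1) * c ^ (-σ₀), by positivity⟩ with hD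
      have hDv : (D : ℝ) = (M + 1) * c ^ (-σ₀) := rfl
      have hD0 : D ≠ 0 := by
        intro h; have : (D : ℝ) = 0 := by rw [h]; rfl
        rw [hDv] at this
        have : 0 < (M + 1) * c ^ (-σ₀) := by positivity
        linarith
      have hDψ : √b * (lamNorm σ₀ (pd 0 fun y => ψ (c • y)) +
          lamNorm σ₀ (pd 1 fun y => ψ (c • y))) ≤ D := by
        rw [lamNorm_pd_comp_smul σ₀ ψ 0 hc0, lamNorm_pd_comp_smul σ₀ ψ 1 hc0, hDv, add_mul, hM]
        have : 0 ≤ 1 * c ^ (-σ₀) := by positivity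
        linarith
      have hb1 := abs_topPairing_data_le hb hσ0 hσ' hθ hε₀ h₁ h₂
        (fun ε h0 h1 => by obtain ⟨C', K', h⟩ := (H ε h0 h1).1; exact h.cont)
        (fun ε h0 h1 => (H ε h0 h1).2.2.2.2.2.1)
        (fun ε h0 h1 => (H ε h0 h1).2.2.2.1.kinematic)
        (fun ε h0 h1 => (H ε h0 h1).2.2.2.1.init_ξ)
        (fun ε h0 h1 => (H ε h0 h1).2.2.2.1.incompressible)
        (fun ε h0 h1 => (H ε h0 h1).2.2.2.2.2.2)
        (fun ε h0 h1 => (H ε h0 h1).2.2.2.2.1)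
        (hψ.comp_smul hc0.ne') hD0 hDψ
      rw [htr.topPairing_eq hb] at hb1
      have hb2 := (inner_profile_ge hψ hpos hr0.le hr1 N hc0 hc).trans ((le_abs_self _).trans hb1)
      rw [hDv] at hb2
      have hpow : c ^ (-σ₀) = c⁻¹ * (r ^ N * r ^ N) := by
        rw [← Real.rpow_neg_one c, hc, hr, one_div, ← Real.rpow_neg_one 2]
        simp only [← Real.rpow_natCast, ← Real.rpow_mul (zero_le_two (α := ℝ)),
          ← Real.rpow_add (zero_lt_two (α := ℝ))]
        congr 1; ring
      rw [hpow] at hb2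
      -- Dividing the two-sided estimate `c⁻¹ rᴺ A ≤ (M + 1) c⁻¹ r²ᴺ C₁` by this factor leaves a
      -- bound that tends to zero with `N`.
      have hp : 0 < c⁻¹ * r ^ N := by positivity
      refine le_of_mul_le_mul_left ?_ hp
      linarith
    have hlim : Tendsto (fun N : ℕ => ((M + 1) * C₁) * r ^ N) atTop (𝓝 0) := by
      have := (tendsto_pow_atTop_nhds_zero_of_lt_one hr0.le hr1).const_mul ((M + 1) * (C₁ : ℝ))
      rwa [mul_zero] at this
    have : A ≤ 0 := ge_of_tendsto' hlim key
    have : 0 < A := by positivity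
    linarith
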